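/- Fix an uncountable regular cardinal $\kappa$; "small" means "of cardinality $<\kappa$". (For $\kappa$ larger than all cardinalities involved this is no restriction.) For an ordered cancellative commutative monoid $(\mathfrak N,\cdot,1,\prec)$, a submonoid $\mathfrak H\subseteq\mathfrak N$ and a field $\mathbf K$, let $\mathbf K\llbracket\mathfrak H\rrbracket$ be the algebra of functions $s:\mathfrak H\to\mathbf K$ whose support is small and Noetherian in $(\mathfrak H,\succ)$ (every sequence in it has indices $i<j$ with $a_i\succcurlyeq a_j$), with the Cauchy product. A family $(s_i)_{i\in I}$ in it is *summable* if $\bigcup_i\operatorname{supp}s_i$ is small and Noetherian in $(\mathfrak H,\succ)$ and each monomial lies in only finitely many $\operatorname{supp}s_i$; its sum is taken coefficientwise. A $\mathbf K$-linear map is *strongly linear* if it sends summable families to summable families and commutes with their sums. Write $s\prec t$ if $t\ne0$ and every $\mathfrak m\in\operatorname{supp}s$ satisfies $\mathfrak m\prec\mathfrak n$ for some $\mathfrak n\in\operatorname{supp}t$. A linear map $\Phi$ from such an algebra to itself is *contracting* if $\Phi(s)\prec s$ for all $s\neq0$ (in particular for all monomials $s$). Let $\mathbf K$ be an ordered field,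 $\mathfrak M$ a non-trivial linearly ordered abelian group, and $\mathbb S=\mathbf K\llbracket\mathfrak M\rrbracket$, ordered by the sign of the leading coefficient; $\mathfrak d_s=\max\operatorname{supp}s$ denotes the dominant monomial of $s\ne0$. Let $\ell:(\mathfrak M,\cdot,<)\to(\mathbb S,+,<)$ be an embedding of ordered groups whose image is closed under truncation (restricting a series to a final segment of $(\mathfrak M,\prec)$), and let $\partial:\mathbb S\to\mathbb S$, $s\mapsto s'$, be a strongly linear derivation with $\partial(\ell(\mathfrak m))=\mathfrak m^\dagger:=\mathfrak m'/\mathfrak m$ for all $\mathfrak m\in\mathfrak M$. Let $\mathfrak S\subseteq\mathfrak M$ be a final segment. Order the monoid $\mathfrak M\times_{\mathfrak S}X^{\mathbb N}=\{\mathfrak mX^k:\mathfrak m\in\mathfrak M,\,k\in\mathbb N\}$ by: $\mathfrak mX^k\prec_{\mathfrak S}\mathfrak nX^{l}$ iff either $k=l$ and $\mathfrak m\prec\mathfrak n$, or $k>l$ and $\mathfrak m\mathfrak n^{-1}\preccurlyeq\mathfrak u^{-(k-l)}$ for some $\mathfrak u\in\mathfrak S$. Consider the subgroup $$\mathfrak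 S^{-\dagger}=\{\mathfrak m\in\mathfrak M:\ \mathfrak m^\dagger=0\ \text{ or }\ \mathfrak d_{\mathfrak m^\dagger}\in\mathfrak S^{-1}\}$$ of $\mathfrak M$, and put $\mathbb S_{[\mathfrak S]}=\mathbf K\llbracket\mathfrak S^{-\dagger}\rrbracket\subseteq\mathbb S$ and $\mathbb S_{[\mathfrak S]}\llbracket X\rrbracket_{\mathfrak S}=\mathbf K\llbracket\mathfrak S^{-\dagger}\times_{\mathfrak S}X^{\mathbb N}\rrbracket$ (with the ordering induced by $\prec_{\mathfrak S}$), which is naturally included in $\mathbb S\llbracket X\rrbracket$. Let $\overline\partial\big(\sum_kP_kX^k\big)=\sum_kP_k'X^k$. Assume that $\partial(\mathfrak S^{-\dagger})\subseteq\mathbb S_{[\mathfrak S]}$. Then 1. $P\mapsto X\cdot\overline\partial(P)$ maps $\mathbb S_{[\mathfrak S]}\llbracket X\rrbracket_{\mathfrak S}$ into itself, and is a strongly linear and contracting derivation of this algebra; 2. the function $\mathbb S_{[\mathfrak S]}\to\mathbb S_{[\mathfrak S]}\llbracket X\rrbracket_{\mathfrak S}$, $s\mapsto\sum_{k\in\mathbb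 N}\frac{s^{(k)}}{k!}X^k$, is well defined and is a strongly linear morphism of (unital) $\mathbf K$-algebras. -/

import Mathlib

open Cardinal

universe u v

noncomputable section

/-! ### Algebras of Noetherian series

Monomials live in a commutative cancellative ordered monoid `N`, written multiplicatively, where
`m < n` is the relation `m ≺ n`. Noetherian subsets of `(N, ≻)` are the partially well-ordered
subsets of the order dual of `N`, so series over `N` are Hahn series with exponents in
`Expo N`. -/

/-- Exponents: the monomials of `N`, written additively and with the reverse ordering. -/
def Expo (N : Type u) : Type u := Additive Nᵒᵈ

namespace Expo

/-- The exponent corresponding to a monomial. -/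
def of {N : Type u} (m : N) : Expo N := Additive.ofMul (OrderDual.toDual m)

/-- The monomial corresponding to an exponent. -/
def mon {N : Type u} (a : Expo N) : N := OrderDual.ofDual (Additive.toMul a)

instance {N : Type u} [PartialOrder N] : PartialOrder (Expo N) :=
  inferInstanceAs (PartialOrder (Additive Nᵒᵈ))

instance {N : Type u} [LinearOrder N] : LinearOrder (Expo N) :=
  inferInstanceAs (LinearOrder (Additive Nᵒᵈ))

instance {N : Type u} [CommMonoid N] : AddCommMonoid (Expo N) :=
  inferInstanceAs (AddCommMonoid (Additive Nᵒᵈ))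

instance {N : Type u} [CommMonoid N] [PartialOrder N] [IsOrderedCancelMonoid N] :
    IsOrderedCancelAddMonoid (Expo N) :=
  inferInstanceAs (IsOrderedCancelAddMonoid (Additive Nᵒᵈ))

end Expo

/-- All series `N → K` with Noetherian support in `(N, ≻)`, without cardinality restriction. -/
abbrev FullSeries (K : Type v) (N : Type u) [Zero K] [PartialOrder N] : Type (max u v) :=
  HahnSeries (Expo N) K

/-- A subset of `N` is Noetherian for the reverse ordering `≻`: every sequence in it has
indices `i < j` with `a i ≽ a j`. -/
def IsNoetherianSet {N : Type u} [PartialOrder N] (A : Set N) : Prop :=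
  (Expo.mon ⁻¹' A : Set (Expo N)).IsPWO

namespace FullSeries

variable {K : Type v} {N : Type u} [Zero K] [PartialOrder N]

/-- The coefficient of the monomial `m` in `s`. -/
def cf (s : FullSeries K N) (m : N) : K := s.coeff (Expo.of m)

/-- The support of a series, as a set of monomials. -/
def supp (s : FullSeries K N) : Set N := {m | s.cf m ≠ 0}

end FullSeries

/-- The algebra `K⟦H⟧` of Noetherian series with coefficients in `K` and monomials in a submonoid
`H` of `N`, with the ordering induced by `N`: the supports are Noetherian subsets of `(H, ≻)` which
are small, that is, of cardinality `< κ`. -/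
def NSeries (κ : Cardinal.{u}) [hκ : Fact κ.IsRegular] (K : Type v) [Field K] {N : Type u}
    [CommMonoid N] [PartialOrder N] [IsOrderedCancelMonoid N] (H : Submonoid N) :
    Subalgebra K (FullSeries K N) where
  carrier := {s | s.cardSupp < κ ∧ s.supp ⊆ H}
  mul_mem' := by
    rintro s t ⟨hs, hs'⟩ ⟨ht, ht'⟩
    refine ⟨(HahnSeries.cardSupp_mul_le _ _).trans_lt (mul_lt_of_lt hκ.out.1 hs ht), ?_⟩
    intro m hm
    obtain ⟨a, ha, b, hb, hab⟩ :=
      HahnSeries.support_mul_subset (show Expo.of m ∈ (s * t).support from hm)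
    have h1 : a.mon ∈ H := hs' ha
    have h2 : b.mon ∈ H := ht' hb
    have h3 : a.mon * b.mon = m :=
      hab
    rw [← h3]
    exact H.mul_mem h1 h2
  add_mem' := by
    rintro s t ⟨hs, hs'⟩ ⟨ht, ht'⟩
    refine ⟨(HahnSeries.cardSupp_add_le _ _).trans_lt (add_lt_of_lt hκ.out.1 hs ht), ?_⟩
    intro m hm
    rcases HahnSeries.support_add_subset s t (show Expo.of m ∈ (s + t).support from hm) with h | h
    · exact hs' h
    · exact ht' h
  algebraMap_mem' := by
    intro r
    have hr : algebraMap K (FullSeries K N) r = HahnSeries.single 0 r := by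
      rw [HahnSeries.algebraMap_apply]; rfl
    refine ⟨?_, ?_⟩
    · rw [hr]
      exact (HahnSeries.cardSupp_single_le _ _).trans_lt (one_lt_aleph0.trans_le hκ.out.1)
    · rw [hr]
      intro m hm
      have h0 : Expo.of m = 0 :=
        HahnSeries.support_single_subset (show Expo.of m ∈ (HahnSeries.single 0 r).support from hm)
      have h1 : m = 1 := h0
      rw [h1]
      exact H.one_mem

/-- `H ≤ H'` induces the inclusion `K⟦H⟧ ⊆ K⟦H'⟧`. -/
theorem NSeries.mono (κ : Cardinal.{u}) [Fact κ.IsRegular] (K : Type v) [Field K] {N : Type u}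
    [CommMonoid N] [PartialOrder N] [IsOrderedCancelMonoid N] {H H' : Submonoid N} (h : H ≤ H') :
    NSeries κ K H ≤ NSeries κ K H' :=
  fun _ hs => ⟨hs.1, fun _ hm => h (hs.2 hm)⟩

section Summability

variable {κ : Cardinal.{u}} [hκ : Fact κ.IsRegular] {K : Type v} [Field K]
  {N : Type u} [CommMonoid N] [PartialOrder N] [IsOrderedCancelMonoid N] {H : Submonoid N}
  {P : Type u} [CommMonoid P] [PartialOrder P] [IsOrderedCancelMonoid P] {J : Submonoid P}

/-- A family `(s i)` in `K⟦H⟧` is summable: the union of the supports is a (small) Noetherian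
subset of `(N, ≻)` and each monomial lies in finitely many of the supports. -/
def IsNSummable {I : Type*} (s : I → NSeries κ K H) : Prop :=
  IsNoetherianSet (⋃ i, (s i : FullSeries K N).supp) ∧
  #(⋃ i, (s i : FullSeries K N).supp : Set N) < κ ∧
  ∀ m : N, {i | m ∈ (s i : FullSeries K N).supp}.Finite

/-- The sum of a summable family: the coefficients are the (finite) sums of coefficients. -/
def nsum {I : Type*} (s : I → NSeries κ K H) (hs : IsNSummable s) : NSeries κ K H :=
  have key : Function.support (fun a : Expo N =>
      ∑ᶠ i, (s i : FullSeries K N).coeff a) ⊆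
      (⋃ i, (s i : FullSeries K N).support) := by
    intro a ha
    by_contra h
    refine ha (finsum_eq_zero_of_forall_eq_zero fun i => ?_)
    by_contra hi
    exact h (Set.mem_iUnion.2 ⟨i, hi⟩)
  ⟨⟨fun a => ∑ᶠ i, (s i : FullSeries K N).coeff a, by
      refine Set.IsPWO.mono ?_ key
      have h := hs.1
      unfold IsNoetherianSet at h
      rw [Set.preimage_iUnion] at h
      exact h⟩,
    by
      refine ⟨(mk_le_mk_of_subset key).trans_lt ?_, ?_⟩
      · have h := hs.2.1
        exact h
      · intro m hm
        obtain ⟨i, hi⟩ := Set.mem_iUnion.1 (key hm)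
        exact (s i).2.2 hi⟩

/-- A map `K⟦H⟧ → K⟦J⟧` commuting with all sums of summable families. Only finitely many members
of a summable family have a given monomial in their support, so up to zero members it is indexed
by a type in the universe of the monomials. -/
def IsStronglyLinear (Φ : NSeries κ K H →ₗ[K] NSeries κ K J) : Prop :=
  ∀ (I : Type u) (s : I → NSeries κ K H) (hs : IsNSummable s),
    ∃ hΦ : IsNSummable (fun i => Φ (s i)), Φ (nsum s hs) = nsum (fun i => Φ (s i)) hΦ

/-- The dominance relation `s ≺ t`. -/
def IsDominatedBy (s t : NSeries κ K H) : Prop :=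
  t ≠ 0 ∧ ∀ m ∈ (s : FullSeries K N).supp, ∃ n ∈ (t : FullSeries K N).supp, m < n

/-- `Φ` is contracting: `Φ s ≺ s` for all `s ≠ 0`, in particular for all monomials in `H`. -/
def IsContracting (Φ : NSeries κ K H →ₗ[K] NSeries κ K H) : Prop :=
  ∀ s : NSeries κ K H, s ≠ 0 → IsDominatedBy (Φ s) s

/-- The monomial `m`, as a series with coefficient `1`. -/
def nmono (κ : Cardinal.{u}) [hκ : Fact κ.IsRegular] (K : Type v) [Field K] (m : N) :
    NSeries κ K (⊤ : Submonoid N) :=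
  ⟨HahnSeries.single (Expo.of m) 1,
    (HahnSeries.cardSupp_single_le _ _).trans_lt (one_lt_aleph0.trans_le hκ.out.1),
    fun _ _ => trivial⟩

theorem nmono_mul (m n : N) : nmono κ K (m * n) = nmono κ K m * nmono κ K n := by
  apply Subtype.ext
  change HahnSeries.single (Expo.of (m * n)) (1 : K) =
    HahnSeries.single (Expo.of m) 1 * HahnSeries.single (Expo.of n) 1
  rw [HahnSeries.single_mul_single, mul_one]
  rfl

theorem nmono_one : nmono κ K (1 : N) = 1 := rfl

end Summability

/-! ### Differential pre-logarithmic Hahn fields -/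

section Hahn

variable {κ : Cardinal.{u}} [hκ : Fact κ.IsRegular] {K : Type v} [Field K]
  {M : Type u} [CommGroup M] [LinearOrder M] [IsOrderedMonoid M]

/-- The Hahn field `𝕊 = K⟦M⟧` of a linearly ordered abelian group `M`. -/
abbrev HahnField (κ : Cardinal.{u}) [Fact κ.IsRegular] (K : Type v) [Field K] (M : Type u)
    [CommGroup M] [LinearOrder M] [IsOrderedMonoid M] : Type (max u v) :=
  NSeries κ K (⊤ : Submonoid M)

/-- The dominant monomial `𝔡_s = max (supp s)` of a non-zero series. -/
def domMonomial (s : HahnField κ K M) : M :=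
  (s : FullSeries K M).order.mon

/-- The ordering of `𝕊`: `s < t` iff `t - s` has a positive leading coefficient. -/
def hahnLT [LinearOrder K] (s t : HahnField κ K M) : Prop :=
  0 < ((t - s : HahnField κ K M) : FullSeries K M).leadingCoeff

/-- `t` is a truncation of `s`: it consists of the terms of `s` whose monomials lie in some final
segment of `(M, ≺)`, i.e. in some initial segment of `(M, ≻)`. -/
def IsTruncation (t s : HahnField κ K M) : Prop :=
  ∃ F : UpperSet M, ∀ m : M,
    (m ∈ F → (t : FullSeries K M).cf m = (s : FullSeries K M).cf m) ∧
    (m ∉ F → (t : FullSeries K M).cf m = 0)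

def IsTruncationClosed (C : Set (HahnField κ K M)) : Prop :=
  ∀ s ∈ C, ∀ t, IsTruncation t s → t ∈ C

/-- The logarithmic derivative `m† = m' / m` of a monomial. -/
def logDer (D : Derivation K (HahnField κ K M) (HahnField κ K M)) (m : M) : HahnField κ K M :=
  D (nmono κ K m) * nmono κ K m⁻¹

/-- `(𝕊, ℓ, D)` is a differential pre-logarithmic Hahn field. -/
structure IsDiffPreLogHahnField [LinearOrder K] (l : M → HahnField κ K M)
    (D : Derivation K (HahnField κ K M) (HahnField κ K M)) : Prop where
  map_mul : ∀ m n : M, l (m * n) = l m + l n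
  strictMono : ∀ m n : M, m < n → hahnLT (l m) (l n)
  stronglyLinear : IsStronglyLinear (D : HahnField κ K M →ₗ[K] HahnField κ K M)
  der_log : ∀ m : M, D (l m) = logDer D m

theorem nmono_mul_inv (m : M) : nmono κ K m * nmono κ K m⁻¹ = 1 := by
  rw [← nmono_mul, mul_inv_cancel, nmono_one]

theorem logDer_one (D : Derivation K (HahnField κ K M) (HahnField κ K M)) :
    logDer D (1 : M) = 0 := by
  unfold logDer
  rw [nmono_one, D.map_one_eq_zero, zero_mul]

theorem logDer_mul (D : Derivation K (HahnField κ K M) (HahnField κ K M)) (m n : M) :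
    logDer D (m * n) = logDer D m + logDer D n := by
  unfold logDer
  rw [mul_inv, nmono_mul, nmono_mul, D.leibniz, smul_eq_mul, smul_eq_mul]
  have h1 := nmono_mul_inv (κ := κ) (K := K) m
  have h2 := nmono_mul_inv (κ := κ) (K := K) n
  linear_combination (D (nmono κ K n) * nmono κ K n⁻¹) * h1 +
    (D (nmono κ K m) * nmono κ K m⁻¹) * h2

theorem logDer_inv (D : Derivation K (HahnField κ K M) (HahnField κ K M)) (m : M) :
    logDer D m⁻¹ = -logDer D m := by
  have h := logDer_mul D m m⁻¹
  rw [mul_inv_cancel, logDer_one] at h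
  exact (neg_eq_of_add_eq_zero_right h.symm).symm

/-- The subgroup of all monomials `m` with `𝔡_{m†} ∈ S⁻¹`, including those with `m† = 0`. -/
def cutSubgroup (S : UpperSet M) (D : Derivation K (HahnField κ K M) (HahnField κ K M)) :
    Subgroup M where
  carrier := {m | logDer D m = 0 ∨ ∃ u ∈ S, domMonomial (logDer D m) = u⁻¹}
  one_mem' := Or.inl (logDer_one D)
  inv_mem' := by
    intro m hm
    have hd : domMonomial (logDer D m⁻¹) = domMonomial (logDer D m) := by
      rw [logDer_inv]
      unfold domMonomial
      rw [NegMemClass.coe_neg, HahnSeries.order_neg]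
    rcases hm with hm | ⟨u, hu, hm⟩
    · left
      rw [logDer_inv, hm, neg_zero]
    · exact Or.inr ⟨u, hu, hd.trans hm⟩
  mul_mem' := by
    intro m n hm hn
    by_cases h0 : logDer D (m * n) = 0
    · exact Or.inl h0
    by_cases hm0 : logDer D m = 0
    · have : logDer D (m * n) = logDer D n := by rw [logDer_mul, hm0, zero_add]
      simpa only [Set.mem_ofPred_eq, this] using hn
    by_cases hn0 : logDer D n = 0
    · have : logDer D (m * n) = logDer D m := by rw [logDer_mul, hn0, add_zero]
      simpa only [Set.mem_ofPred_eq, this] using hm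
    obtain ⟨u, hu, hmu⟩ := hm.resolve_left hm0
    obtain ⟨w, hw, hnw⟩ := hn.resolve_left hn0
    refine Or.inr ⟨(domMonomial (logDer D (m * n)))⁻¹, ?_, (inv_inv _).symm⟩
    have hne : (logDer D m : FullSeries K M) + (logDer D n : FullSeries K M) ≠ 0 := by
      intro h
      apply h0
      rw [logDer_mul]
      exact Subtype.ext h
    have hle : domMonomial (logDer D (m * n)) ≤
        max (domMonomial (logDer D m)) (domMonomial (logDer D n)) := by
      rw [logDer_mul]
      exact HahnSeries.min_order_le_order_add hne
    rw [hmu, hnw] at hle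
    rcases le_max_iff.1 hle with h | h
    · exact S.upper (le_inv_of_le_inv h) hu
    · exact S.upper (le_inv_of_le_inv h) hw

end Hahn

/-! ### The algebra of power series given by a cut -/

section Cut

variable {M : Type u} [CommGroup M] [LinearOrder M] [IsOrderedMonoid M]

/-- The monoid `M ×_S X^ℕ` of formal products `m X^k`. -/
@[ext]
structure CutMonoid (S : UpperSet M) : Type u where
  mon : M
  exp : ℕ

/-- The set of all `m X^k`, with `k ∈ ℤ`, that are `≺_S 1`. -/
def negCone (S : UpperSet M) : Set (M × ℤ) :=
  {p | (p.2 = 0 ∧ p.1 < 1) ∨ (0 < p.2 ∧ ∃ u ∈ S, p.1 ≤ u ^ (-p.2))}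

theorem negCone_mul (S : UpperSet M) {p q : M × ℤ} (hp : p ∈ negCone S) (hq : q ∈ negCone S) :
    (p.1 * q.1, p.2 + q.2) ∈ negCone S := by
  rcases hp with ⟨hp, hp'⟩ | ⟨hp, u, hu, hp'⟩ <;> rcases hq with ⟨hq, hq'⟩ | ⟨hq, w, hw, hq'⟩
  · exact Or.inl ⟨by simp [hp, hq], mul_lt_one' hp' hq'⟩
  · refine Or.inr ⟨by simp [hp, hq], w, hw, ?_⟩
    simpa [hp] using mul_le_mul' hp'.le hq'
  · refine Or.inr ⟨by simp [hp, hq], u, hu, ?_⟩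
    simpa [hq] using mul_le_mul' hp' hq'.le
  · refine Or.inr ⟨add_pos hp hq, min u w, ?_, ?_⟩
    · rcases min_choice u w with h | h <;> rw [h] <;> assumption
    · have key : ∀ (a b : M) (k : ℤ), 0 < k → a ≤ b → b ^ (-k) ≤ a ^ (-k) := by
        intro a b k hk hab
        rw [zpow_neg, zpow_neg]
        exact inv_le_inv_iff.2 (zpow_le_zpow_left hk.le hab)
      have h1 := hp'.trans (key _ _ _ hp (min_le_left u w))
      have h2 := hq'.trans (key _ _ _ hq (min_le_right u w))
      simpa only [neg_add, zpow_add] using mul_le_mul' h1 h2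

theorem one_notMem_negCone (S : UpperSet M) : ((1, 0) : M × ℤ) ∉ negCone S := by
  rintro (⟨_, h⟩ | ⟨h, _⟩)
  · exact lt_irrefl _ h
  · exact lt_irrefl _ h

namespace CutMonoid

variable {S : UpperSet M}

instance : CommMonoid (CutMonoid S) where
  mul a b := ⟨a.mon * b.mon, a.exp + b.exp⟩
  one := ⟨1, 0⟩
  mul_assoc a b c := CutMonoid.ext (mul_assoc _ _ _) (add_assoc _ _ _)
  one_mul a := CutMonoid.ext (one_mul _) (zero_add _)
  mul_one a := CutMonoid.ext (mul_one _) (add_zero _)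
  mul_comm a b := CutMonoid.ext (mul_comm _ _) (add_comm _ _)

theorem mon_mul (a b : CutMonoid S) : (a * b).mon = a.mon * b.mon := rfl
theorem exp_mul (a b : CutMonoid S) : (a * b).exp = a.exp + b.exp := rfl

/-- The strict ordering `a ≺_S b`. -/
def Below (a b : CutMonoid S) : Prop :=
  (a.mon * b.mon⁻¹, (a.exp : ℤ) - b.exp) ∈ negCone S

theorem Below.trans {a b c : CutMonoid S} (h : Below a b) (h' : Below b c) : Below a c := by
  have := negCone_mul S h h'
  unfold Below
  convert this using 2
  · simp
  · simp

theorem not_below_self (a : CutMonoid S) : ¬ Below a a := by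
  intro h
  unfold Below at h
  rw [mul_inv_cancel, sub_self] at h
  exact one_notMem_negCone S h

/-- The partial ordering of `M ×_S X^ℕ`. -/
instance : PartialOrder (CutMonoid S) where
  le a b := a = b ∨ Below a b
  lt a b := Below a b
  le_refl a := Or.inl rfl
  le_trans a b c := by
    rintro (rfl | h) (rfl | h')
    · exact Or.inl rfl
    · exact Or.inr h'
    · exact Or.inr h
    · exact Or.inr (h.trans h')
  le_antisymm a b := by
    rintro (rfl | h) (h' | h')
    · rfl
    · rfl
    · exact h'.symm
    · exact absurd (h.trans h') (not_below_self a)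
  lt_iff_le_not_ge a b := by
    constructor
    · intro h
      refine ⟨Or.inr h, ?_⟩
      rintro (rfl | h')
      · exact not_below_self _ h
      · exact not_below_self _ (h.trans h')
    · rintro ⟨rfl | h, h'⟩
      · exact absurd (Or.inl rfl) h'
      · exact h

theorem le_iff (a b : CutMonoid S) : a ≤ b ↔ a = b ∨ Below a b := Iff.rfl

theorem below_mul_left (a b c : CutMonoid S) : Below (a * b) (a * c) ↔ Below b c := by
  unfold Below
  have h1 : (a * b).mon * ((a * c).mon)⁻¹ = b.mon * c.mon⁻¹ := by
    rw [mon_mul, mon_mul, mul_inv]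
    calc a.mon * b.mon * (a.mon⁻¹ * c.mon⁻¹) = (a.mon * a.mon⁻¹) * (b.mon * c.mon⁻¹) := by
          exact mul_mul_mul_comm _ _ _ _
      _ = _ := by rw [mul_inv_cancel, one_mul]
  have h2 : ((a * b).exp : ℤ) - (a * c).exp = (b.exp : ℤ) - c.exp := by
    rw [exp_mul, exp_mul]
    push_cast
    ring
  rw [h1, h2]

theorem mul_left_inj' {a b c : CutMonoid S} (h : a * b = a * c) : b = c := by
  have h1 := congrArg CutMonoid.mon h
  have h2 := congrArg CutMonoid.exp h
  rw [mon_mul, mon_mul] at h1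
  rw [exp_mul, exp_mul] at h2
  exact CutMonoid.ext (mul_left_cancel h1) (Nat.add_left_cancel h2)

instance : IsOrderedCancelMonoid (CutMonoid S) where
  mul_le_mul_left a b h c := by
    rw [mul_comm a c, mul_comm b c]
    rcases h with rfl | h
    · exact le_rfl
    · exact Or.inr ((below_mul_left _ _ _).2 h)
  le_of_mul_le_mul_left a b c h := by
    rcases h with h | h
    · exact Or.inl (mul_left_inj' h)
    · exact Or.inr ((below_mul_left _ _ _).1 h)

/-- The submonoid `H ×_S X^ℕ`, with the ordering induced from `M ×_S X^ℕ`. -/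
def overSub (S : UpperSet M) (H : Submonoid M) : Submonoid (CutMonoid S) where
  carrier := {a | a.mon ∈ H}
  one_mem' := H.one_mem
  mul_mem' ha hb := H.mul_mem ha hb

theorem le_of_exp (k : ℕ) {m n : M} (h : (⟨m, k⟩ : CutMonoid S) ≤ ⟨n, k⟩) : m ≤ n := by
  rcases h with h | h
  · exact (congrArg CutMonoid.mon h).le
  · rcases h with ⟨_, h⟩ | ⟨h, _⟩
    · exact (mul_inv_lt_iff_lt_mul.1 h).le.trans_eq (one_mul n)
    · simp at h

end CutMonoid

variable {κ : Cardinal.{u}} [hκ : Fact κ.IsRegular] {K : Type v} [Field K]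
  {S : UpperSet M} {H : Submonoid M}

/-- The algebra `K⟦H⟧⟦X⟧_S = K⟦H ×_S X^ℕ⟧`, for a submonoid `H` of `M`. -/
abbrev CutSeries (κ : Cardinal.{u}) [Fact κ.IsRegular] (K : Type v) [Field K]
    (S : UpperSet M) (H : Submonoid M) : Subalgebra K (FullSeries K (CutMonoid S)) :=
  NSeries κ K (CutMonoid.overSub S H)

/-- The coefficient of `X^k` in `P`, as an element of `𝕊 = K⟦M⟧`. -/
def xCoeff (k : ℕ) (P : CutSeries κ K S H) : HahnField κ K M :=
  ⟨⟨fun a => (P : FullSeries K (CutMonoid S)).cf ⟨a.mon, k⟩, by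
      intro f
      obtain ⟨i, j, hij, h⟩ := (P : FullSeries K (CutMonoid S)).isPWO_support
        (fun i => ⟨Expo.of ⟨(f i).1.mon, k⟩, (f i).2⟩)
      exact ⟨i, j, hij, CutMonoid.le_of_exp (S := S) k h⟩⟩,
    by
      refine ⟨lt_of_le_of_lt ?_ P.2.1, fun _ _ => trivial⟩
      refine Cardinal.mk_le_of_injective
        (f := fun a => ⟨Expo.of ⟨a.1.mon, k⟩, a.2⟩) ?_
      intro a b hab
      have h := congrArg Subtype.val hab
      exact Subtype.ext (congrArg CutMonoid.mon h)⟩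

/-- The natural inclusion `K⟦H⟧⟦X⟧_S → 𝕊⟦X⟧`. -/
def toPower (P : CutSeries κ K S H) : PowerSeries (HahnField κ K M) :=
  PowerSeries.mk fun k => xCoeff k P

/-- The coefficientwise extension `∑ P_k X^k ↦ ∑ (P_k)' X^k` of a derivation of `𝕊`. -/
def barDer (D : Derivation K (HahnField κ K M) (HahnField κ K M))
    (P : PowerSeries (HahnField κ K M)) : PowerSeries (HahnField κ K M) :=
  PowerSeries.mk fun k => D (PowerSeries.coeff k P)

/-- The Taylor series `∑ (s^(k) / k!) X^k` of `s`. -/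
def taylor (D : Derivation K (HahnField κ K M) (HahnField κ K M)) (s : HahnField κ K M) :
    PowerSeries (HahnField κ K M) :=
  PowerSeries.mk fun k => ((k.factorial : K)⁻¹) • (D^[k] s)

end Cut

end

/-! ### Noetherian sets of monomials -/

section Noetherian

variable {N : Type u} [PartialOrder N]

/-! Everything reduces to one combinatorial fact: replacing each `m X^k` in a Noetherian set by the
terms of `m' X^(k+1)` gives a Noetherian set (`isNoetherianSet_derStep`). In a putative bad sequence
of terms `b i`, the sources `a i = m i X^(k i)` may be taken decreasing. If the exponents `k i` are
eventually constant, strong linearity of the derivation on `{m i}` concludes. Otherwise they may be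
taken strictly increasing; write the monomial of `b i` as `m i * q i`, with `q i` in the support of
the logarithmic derivative of `m i`. Then the `m i` decrease at least at slopes from `S`, while the
`m i * q i` stay above every line with slope in `S`, so `q` is strictly increasing.

Strong linearity forbids `g n` decreasing and `g n * q n` strictly increasing with `q n` in the
support of the logarithmic derivative of `g n` (`not_strictMono_mul_of_antitone`). To reach this
situation, the `m i` are tilted by products of powers of elements of `S`. The coefficient of a given
`q` in the logarithmic derivative is a homomorphism from the monomials to `K`, so the tilt changes
it additively. A sparse subsequence, a choice between two tilts and characteristic zero keep it
non-zero (`not_forall_logDerCoeff_ne_zero`).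

On the subgroup attached to the cut, each term of `m' X^(k+1)` lies strictly below `m X^k`
(`lt_of_mem_derStep`). This gives contraction, and, by a minimal bad sequence argument
(`isNoetherianSet_of_parents`), Noetherianity of the union of all iterates, which contains the
support of the Taylor series. Strong linearity is then checked one power of `X` at a time
(`isStronglyLinear_of_xCoeff`), and multiplicativity of the Taylor map follows from uniqueness of
solutions of `dF/dX = barDer D F` (`eq_taylor`). -/

theorem isNoetherianSet_iff_partiallyWellOrderedOn {A : Set N} :
    IsNoetherianSet A ↔ A.PartiallyWellOrderedOn (fun a b => b ≤ a) := Iff.rfl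

theorem isNoetherianSet_iff {A : Set N} :
    IsNoetherianSet A ↔ ∀ f : ℕ → N, (∀ n, f n ∈ A) → ∃ i j, i < j ∧ f j ≤ f i := by
  rw [isNoetherianSet_iff_partiallyWellOrderedOn, Set.partiallyWellOrderedOn_iff_exists_lt]

theorem IsNoetherianSet.mono {A B : Set N} (hB : IsNoetherianSet B) (h : A ⊆ B) :
    IsNoetherianSet A :=
  Set.IsPWO.mono hB fun _ ha => h ha

theorem IsNoetherianSet.union {A B : Set N} (hA : IsNoetherianSet A) (hB : IsNoetherianSet B) :
    IsNoetherianSet (A ∪ B) :=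
  Set.IsPWO.union hA hB

theorem IsNoetherianSet.exists_antitone_subseq {A : Set N} (hA : IsNoetherianSet A) {f : ℕ → N}
    (hf : ∀ n, f n ∈ A) : ∃ g : ℕ ↪o ℕ, Antitone (f ∘ g) := by
  obtain ⟨g, hg⟩ := Set.PartiallyWellOrderedOn.exists_monotone_subseq
    (isNoetherianSet_iff_partiallyWellOrderedOn.1 hA) hf
  exact ⟨g, fun m n h => hg m n h⟩

theorem Antitone.isNoetherianSet_range {g : ℕ → N} (hg : Antitone g) :
    IsNoetherianSet (Set.range g) := by
  rw [isNoetherianSet_iff]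
  intro f hf
  choose p hp using hf
  obtain ⟨i, j, hij, h⟩ := Set.partiallyWellOrderedOn_iff_exists_lt.1
    (Set.isPWO_of_wellQuasiOrderedLE (Set.univ : Set ℕ)) p (fun _ => trivial)
  exact ⟨i, j, hij, by rw [← hp i, ← hp j]; exact hg h⟩

theorem FullSeries.isNoetherianSet_supp {K : Type v} [Zero K] (s : FullSeries K N) :
    IsNoetherianSet s.supp := s.isPWO_support

/-- If infinitely many terms belonged to `A`, they would form a strictly increasing sequence in it.
-/
theorem IsNoetherianSet.eventually_notMem {A : Set N} (hA : IsNoetherianSet A) {q : ℕ → N}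
    (hq : StrictMono q) : ∀ᶠ i in Filter.atTop, q i ∉ A := by
  by_contra h
  rw [Filter.not_eventually] at h
  obtain ⟨φ, hφ, hφA⟩ := Filter.extraction_of_frequently_atTop h
  obtain ⟨i, j, hij, hle⟩ := isNoetherianSet_iff.1 hA (q ∘ φ) fun n => not_not.1 (hφA n)
  exact absurd hle (hq (hφ hij)).not_ge

end Noetherian

/-! ### Countable sets and countable unions of small sets. -/

section Small

theorem mk_iUnion_nat_lt {κ : Cardinal.{u}} [hκ : Fact κ.IsRegular] (h0 : ℵ₀ < κ) {α : Type u} {A : ℕ → Set α} (hA : ∀ k, #(A k) < κ) :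
    #(⋃ k, A k : Set α) < κ := by
  have := (card_iUnion_lt_iff_forall_of_isRegular (t := fun k : ULift.{u} ℕ => A k.down)
    hκ.out (by simpa using h0)).2 fun k => hA k.down
  refine (mk_le_mk_of_subset ?_).trans_lt this
  exact Set.iUnion_subset fun k => Set.subset_iUnion (fun k : ULift.{u} ℕ => A k.down) ⟨k⟩

theorem Set.Countable.mk_lt {κ : Cardinal.{u}} (h0 : ℵ₀ < κ) {α : Type u} {A : Set α} (hA : A.Countable) : #A < κ :=
  (Cardinal.mk_le_aleph0_iff.2 hA.to_subtype).trans_lt h0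

end Small

/-! ### Summable families -/

section Summable

variable {κ : Cardinal.{u}} [hκ : Fact κ.IsRegular] {K : Type v} [Field K]
  {N : Type u} [CommMonoid N] [PartialOrder N] [IsOrderedCancelMonoid N] {H : Submonoid N}

theorem NSeries.ext_cf {s t : NSeries κ K H}
    (h : ∀ m, (s : FullSeries K N).cf m = (t : FullSeries K N).cf m) : s = t :=
  Subtype.ext (HahnSeries.ext (funext fun a => h a.mon))

theorem NSeries.mk_supp_lt (s : NSeries κ K H) : #(s : FullSeries K N).supp < κ := s.2.1

theorem cf_nsum {I : Type*} (s : I → NSeries κ K H) (hs : IsNSummable s) (m : N) :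
    (nsum s hs : FullSeries K N).cf m = ∑ᶠ i, (s i : FullSeries K N).cf m := rfl

theorem cf_nmono_self (m : N) : (nmono κ K m : FullSeries K N).cf m = 1 :=
  HahnSeries.coeff_single_same _ _

theorem cf_nmono_of_ne {m n : N} (h : n ≠ m) : (nmono κ K m : FullSeries K N).cf n = 0 :=
  HahnSeries.coeff_single_of_ne h

theorem cf_smul (c : K) (s : NSeries κ K H) (m : N) :
    ((c • s : NSeries κ K H) : FullSeries K N).cf m = c * (s : FullSeries K N).cf m := rfl

theorem cf_add (s t : NSeries κ K H) (m : N) :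
    ((s + t : NSeries κ K H) : FullSeries K N).cf m =
      (s : FullSeries K N).cf m + (t : FullSeries K N).cf m := rfl

theorem supp_smul_subset (c : K) (s : NSeries κ K H) :
    ((c • s : NSeries κ K H) : FullSeries K N).supp ⊆ (s : FullSeries K N).supp := by
  intro m hm h
  exact hm (by rw [cf_smul, h, mul_zero])

theorem supp_smul_nmono_subset (c : K) (m : N) :
    ((c • nmono κ K m : NSeries κ K (⊤ : Submonoid N)) : FullSeries K N).supp ⊆ {m} := by
  intro n hn
  by_contra h
  exact supp_smul_subset _ _ hn (cf_nmono_of_ne h)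

theorem isNSummable_smul_nmono {A : Set N} (hA : IsNoetherianSet A) (hA' : #A < κ) (c : A → K) :
    IsNSummable fun a : A => c a • nmono κ K (a : N) := by
  have h : (⋃ a : A, ((c a • nmono κ K (a : N) : NSeries κ K (⊤ : Submonoid N)) :
      FullSeries K N).supp) ⊆ A := by
    refine Set.iUnion_subset fun a m hm => ?_
    rw [supp_smul_nmono_subset _ _ hm]
    exact a.2
  refine ⟨hA.mono h, (mk_le_mk_of_subset h).trans_lt hA', fun m => ?_⟩
  refine Set.Subsingleton.finite fun a ha b hb => Subtype.ext ?_
  rw [← supp_smul_nmono_subset _ _ ha, ← supp_smul_nmono_subset _ _ hb]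

theorem nsum_smul_nmono (s : NSeries κ K (⊤ : Submonoid N))
    (hs : IsNSummable fun a : (s : FullSeries K N).supp =>
      (s : FullSeries K N).cf a • nmono κ K (a : N)) : nsum _ hs = s := by
  refine NSeries.ext_cf fun m => ?_
  rw [cf_nsum]
  by_cases hm : (s : FullSeries K N).cf m = 0
  · rw [hm]
    refine finsum_eq_zero_of_forall_eq_zero fun a => ?_
    rw [cf_smul, cf_nmono_of_ne, mul_zero]
    rintro rfl
    exact a.2 hm
  · rw [finsum_eq_single _ ⟨m, hm⟩, cf_smul, cf_nmono_self, mul_one]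
    intro a ha
    rw [cf_smul, cf_nmono_of_ne, mul_zero]
    rintro rfl
    exact ha rfl

variable {P : Type u} [CommMonoid P] [PartialOrder P] [IsOrderedCancelMonoid P] {J : Submonoid P}

/-- The monomials of a small Noetherian set form a summable family, hence so do their images. This
is the form in which strong linearity of the derivation enters the combinatorics. -/
theorem IsStronglyLinear.isNoetherianSet_iUnion_supp {Φ : NSeries κ K (⊤ : Submonoid N) →ₗ[K]
    NSeries κ K J} (hΦ : IsStronglyLinear Φ) {A : Set N} (hA : IsNoetherianSet A)
    (hA' : #A < κ) : IsNoetherianSet (⋃ a ∈ A, (Φ (nmono κ K a) : FullSeries K P).supp) := by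
  obtain ⟨h, -⟩ := hΦ A _ (isNSummable_smul_nmono hA hA' fun _ => 1)
  refine h.1.mono ?_
  refine Set.iUnion₂_subset fun a ha => ?_
  refine Set.subset_iUnion_of_subset ⟨a, ha⟩ ?_
  simp only [one_smul]
  exact subset_rfl

theorem IsStronglyLinear.supp_subset {Φ : NSeries κ K (⊤ : Submonoid N) →ₗ[K]
    NSeries κ K J} (hΦ : IsStronglyLinear Φ) (s : NSeries κ K (⊤ : Submonoid N)) :
    (Φ s : FullSeries K P).supp ⊆
      ⋃ a ∈ (s : FullSeries K N).supp, (Φ (nmono κ K a) : FullSeries K P).supp := by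
  have hs := isNSummable_smul_nmono (κ := κ) (s : FullSeries K N).isNoetherianSet_supp (NSeries.mk_supp_lt s)
    fun a => (s : FullSeries K N).cf a
  obtain ⟨h, h'⟩ := hΦ _ _ hs
  rw [nsum_smul_nmono] at h'
  intro m hm
  rw [h'] at hm
  obtain ⟨a, ha⟩ : ∃ a : (s : FullSeries K N).supp,
      (Φ ((s : FullSeries K N).cf a • nmono κ K (a : N)) : FullSeries K P).cf m ≠ 0 := by
    by_contra! h0
    exact hm (by rw [cf_nsum]; exact finsum_eq_zero_of_forall_eq_zero h0)
  rw [map_smul] at ha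
  exact Set.mem_biUnion a.2 (supp_smul_subset _ _ ha)

end Summable

/-! ### Logarithmic derivatives of monomials -/

section LogDer

variable {κ : Cardinal.{u}} [hκ : Fact κ.IsRegular] {K : Type v} [Field K]
  {M : Type u} [CommGroup M] [LinearOrder M] [IsOrderedMonoid M]
  (D : Derivation K (HahnField κ K M) (HahnField κ K M))

/-- The coefficient of `q` in the logarithmic derivative, as a homomorphism from `M` to `K`. -/
noncomputable def logDerCoeff (q : M) : Additive M →+ K where
  toFun m := (logDer D m.toMul : FullSeries K M).cf q
  map_zero' := by
    rw [toMul_zero, logDer_one]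
    rfl
  map_add' m n := by
    rw [toMul_add, logDer_mul, cf_add]

theorem logDerCoeff_apply (q m : M) :
    logDerCoeff D q (Additive.ofMul m) = (logDer D m : FullSeries K M).cf q := rfl

/-- This is `m' = m * m†` read on coefficients: terms of `m'` correspond to terms of `m†` by
translation. -/
theorem cf_der_nmono (m q : M) :
    (D (nmono κ K m) : FullSeries K M).cf (m * q) = logDerCoeff D q (Additive.ofMul m) := by
  have h := HahnSeries.coeff_mul_single_add (r := (1 : K))
    (x := (D (nmono κ K m) : FullSeries K M)) (a := Expo.of (m * q)) (b := Expo.of m⁻¹)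
  rw [mul_one] at h
  rw [logDerCoeff_apply]
  refine h.symm.trans ?_
  have : Expo.of (m * q) + Expo.of m⁻¹ = Expo.of q :=
    congrArg Expo.of (mul_inv_cancel_comm m q)
  rw [this]
  rfl

variable {D}

/-- The range of `g` is Noetherian and countable, so the terms of the derivatives of the `g n` form
a Noetherian set. That set would contain the increasing sequence `g n * q n`. -/
theorem not_strictMono_mul_of_antitone (h0 : ℵ₀ < κ)
    (hD : IsStronglyLinear (D : HahnField κ K M →ₗ[K] HahnField κ K M)) {g q : ℕ → M}
    (hg : Antitone g) (hgq : StrictMono fun n => g n * q n) :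
    ¬ ∀ n, logDerCoeff D (q n) (Additive.ofMul (g n)) ≠ 0 := by
  intro h
  have h1 := hD.isNoetherianSet_iUnion_supp hg.isNoetherianSet_range
    ((Set.countable_range g).mk_lt h0)
  obtain ⟨n, hn⟩ := (h1.eventually_notMem hgq).exists
  refine hn (Set.mem_biUnion (Set.mem_range_self n) ?_)
  show _ ≠ _
  exact (cf_der_nmono D (g n) (q n)).trans_ne (h n)

end LogDer

/-! ### Tilting a sequence of monomials by slopes in the cut. -/

section Slopes

variable {κ : Cardinal.{u}} [hκ : Fact κ.IsRegular] {K : Type v} [Field K]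
  {M : Type u} [CommGroup M] [LinearOrder M] [IsOrderedMonoid M]
  {D : Derivation K (HahnField κ K M) (HahnField κ K M)}

theorem logDerCoeff_mul (q m n : M) : logDerCoeff D q (Additive.ofMul (m * n)) =
    logDerCoeff D q (Additive.ofMul m) + logDerCoeff D q (Additive.ofMul n) := by
  rw [ofMul_mul, map_add]

theorem logDerCoeff_zpow (q m : M) (z : ℤ) : logDerCoeff D q (Additive.ofMul (m ^ z)) =
    z * logDerCoeff D q (Additive.ofMul m) := by
  rw [ofMul_zpow, map_zsmul, zsmul_eq_mul]

theorem logDerCoeff_inv (q m : M) : logDerCoeff D q (Additive.ofMul m⁻¹) =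
    -logDerCoeff D q (Additive.ofMul m) := by
  rw [ofMul_inv, map_neg]

theorem logDerCoeff_prod (q : M) {ι : Type*} (s : Finset ι) (f : ι → M)
    (h : ∀ i ∈ s, logDerCoeff D q (Additive.ofMul (f i)) = 0) :
    logDerCoeff D q (Additive.ofMul (∏ i ∈ s, f i)) = 0 := by
  rw [ofMul_prod, map_sum]
  exact Finset.sum_eq_zero h

theorem eventually_logDerCoeff_eq_zero {q : ℕ → M} (hq : StrictMono q) (m : M) :
    ∀ᶠ i in Filter.atTop, logDerCoeff D (q i) (Additive.ofMul m) = 0 := by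
  filter_upwards [((logDer D m : FullSeries K M).isNoetherianSet_supp).eventually_notMem hq]
    with i hi
  exact not_not.1 hi

theorem zpow_neg_le_zpow_neg_of_le {a b : M} {k : ℤ} (hk : 0 ≤ k) (h : a ≤ b) :
    b ^ (-k) ≤ a ^ (-k) := by
  rw [zpow_neg, zpow_neg]
  exact inv_le_inv_iff.2 (zpow_le_zpow_left hk h)

/-- If the `m i` decrease with slopes in the cut and the `m i * q i` increase with slopes above
the cut, then `q i` is not always in the support of the logarithmic derivative of `m i`. -/
theorem not_forall_logDerCoeff_ne_zero [CharZero K] (h0 : ℵ₀ < κ)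
    (hD : IsStronglyLinear (D : HahnField κ K M →ₗ[K] HahnField κ K M)) (S : UpperSet M)
    {m q : ℕ → M} {k : ℕ → ℤ} {U : ℕ → ℕ → M} (hk : StrictMono k)
    (hU : ∀ i j, i < j → U i j ∈ S) (hm : ∀ i j, i < j → m j ≤ m i * U i j ^ (-(k j - k i)))
    (hv : ∀ i j, i < j → ∀ w ∈ S, (m i * q i) * w ^ (-(k j - k i)) < m j * q j)
    (hz : ∀ i a b, a < i → b < i → logDerCoeff D (q i) (Additive.ofMul (U a b)) = 0) :
    ¬ ∀ i, logDerCoeff D (q i) (Additive.ofMul (m i)) ≠ 0 := by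
  intro h
  -- The tilt `δ` bounds the decrease of `m` and is beaten by the growth of `m * q`. Jumping by two
  -- indices leaves an intermediate slope `U (2n) (2n+1)`, whose coefficient at `q (2n+2)` vanishes
  -- by `hz`; nothing is known there about `U (2n+1) (2n+2)`.
  have step : ∀ n : ℕ, ∃ δ : M, m (2 * n + 2) ≤ m (2 * n) * δ ∧
      (m (2 * n) * q (2 * n)) * δ < m (2 * n + 2) * q (2 * n + 2) ∧
      logDerCoeff D (q (2 * n + 2)) (Additive.ofMul δ) ≠
        logDerCoeff D (q (2 * n + 2)) (Additive.ofMul (m (2 * n + 2))) ∧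
      ∀ i, 2 * n + 2 < i → logDerCoeff D (q i) (Additive.ofMul δ) = 0 := by
    intro n
    set x := U (2 * n) (2 * n + 1) with hx
    -- Take `y` to be the smaller of the two slopes: it remains in `S`, and lowering a slope weakens
    -- the upper bounds on `m`, so `y` may replace either one.
    obtain ⟨y, hyS, hyx, hy', hyz⟩ : ∃ y ∈ S, y ≤ x ∧ y ≤ U (2 * n + 1) (2 * n + 2) ∧
        ∀ i, 2 * n + 2 < i → logDerCoeff D (q i) (Additive.ofMul y) = 0 := by
      rcases le_total x (U (2 * n + 1) (2 * n + 2)) with hle | hle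
      · exact ⟨x, hU _ _ (by omega), le_rfl, hle, fun i hi => hz i _ _ (by omega) (by omega)⟩
      · exact ⟨_, hU _ _ (by omega), hle, le_rfl, fun i hi => hz i _ _ (by omega) (by omega)⟩
    have hxS : x ∈ S := hU _ _ (by omega)
    set A := k (2 * n + 1) - k (2 * n) with hA
    set B := k (2 * n + 2) - k (2 * n + 1) with hB
    have hA0 : 0 < A := sub_pos.2 (hk (by omega))
    have hB0 : 0 < B := sub_pos.2 (hk (by omega))
    have hm1 : m (2 * n + 1) ≤ m (2 * n) * x ^ (-A) := hm _ _ (by omega)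
    have hm2 : m (2 * n + 2) ≤ m (2 * n + 1) * y ^ (-B) :=
      (hm _ _ (by omega)).trans (mul_le_mul_right (zpow_neg_le_zpow_neg_of_le hB0.le hy') _)
    have hv1 : ∀ w ∈ S, (m (2 * n) * q (2 * n)) * w ^ (-A) < m (2 * n + 1) * q (2 * n + 1) :=
      hv _ _ (by omega)
    have hv2 : (m (2 * n + 1) * q (2 * n + 1)) * y ^ (-B) < m (2 * n + 2) * q (2 * n + 2) :=
      hv _ _ (by omega) y hyS
    have hm3 : m (2 * n + 2) ≤ m (2 * n) * (x ^ (-A) * y ^ (-B)) := by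
      rw [← mul_assoc]
      exact hm2.trans (mul_le_mul_left hm1 _)
    have hv3 : ∀ w ∈ S, (m (2 * n) * q (2 * n)) * (w ^ (-A) * y ^ (-B)) <
        m (2 * n + 2) * q (2 * n + 2) := by
      intro w hw
      rw [← mul_assoc]
      exact (mul_lt_mul_left (hv1 w hw) _).trans hv2
    have hxz : ∀ i, 2 * n + 1 < i → logDerCoeff D (q i) (Additive.ofMul x) = 0 :=
      fun i hi => hz i _ _ (by omega) (by omega)
    -- Two tilts are available. At `q (2n+2)` the first has coefficient `-B * c` and the second `-(A
    -- + B) * c`, where `c` is that of `y`. If the first equals the non-zero coefficient of `m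
    -- (2n+2)`, then `c ≠ 0`, and the second differs from it because `A ≠ 0` in characteristic zero.
    by_cases hc : logDerCoeff D (q (2 * n + 2)) (Additive.ofMul (x ^ (-A) * y ^ (-B))) =
        logDerCoeff D (q (2 * n + 2)) (Additive.ofMul (m (2 * n + 2)))
    · refine ⟨y ^ (-A) * y ^ (-B), ?_, hv3 y hyS, ?_, ?_⟩
      · exact hm3.trans (mul_le_mul_right (mul_le_mul_left
          (zpow_neg_le_zpow_neg_of_le hA0.le hyx) _) _)
      · intro hc'
        rw [← hc, logDerCoeff_mul, logDerCoeff_mul, add_left_inj, logDerCoeff_zpow,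
          logDerCoeff_zpow, hxz _ (by omega), mul_zero, mul_eq_zero] at hc'
        have hy0 : logDerCoeff D (q (2 * n + 2)) (Additive.ofMul y) = 0 := by
          refine hc'.resolve_left ?_
          exact_mod_cast (neg_neg_of_pos hA0).ne
        refine h (2 * n + 2) ?_
        rw [← hc, logDerCoeff_mul, logDerCoeff_zpow, logDerCoeff_zpow, hy0, hxz _ (by omega),
          mul_zero, mul_zero, add_zero]
      · intro i hi
        rw [logDerCoeff_mul, logDerCoeff_zpow, logDerCoeff_zpow, hyz i hi, mul_zero, mul_zero,
          add_zero]
    · refine ⟨x ^ (-A) * y ^ (-B), hm3, hv3 x hxS, hc, ?_⟩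
      intro i hi
      rw [logDerCoeff_mul, logDerCoeff_zpow, logDerCoeff_zpow, hyz i hi, hxz i (by omega),
        mul_zero, mul_zero, add_zero]
  choose δ hδm hδv hδc hδz using step
  have hG : ∀ n, m (2 * (n + 1)) * (∏ j ∈ Finset.range (n + 1), δ j)⁻¹ =
      m (2 * n + 2) * (δ n)⁻¹ * (∏ j ∈ Finset.range n, δ j)⁻¹ := by
    intro n
    rw [Finset.prod_range_succ, mul_inv_rev, mul_assoc]
    rfl
  -- Dividing by the accumulated tilts makes the monomials decrease while their products with `q`
  -- increase. At `q (2n+2)` only the last tilt contributes to the coefficient, and it was chosen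
  -- not to cancel that of `m (2n+2)`.
  refine not_strictMono_mul_of_antitone h0 hD
    (g := fun n => m (2 * n) * (∏ j ∈ Finset.range n, δ j)⁻¹) (q := fun n => q (2 * n)) ?_ ?_ ?_
  · refine antitone_nat_of_succ_le fun n => ?_
    rw [hG]
    exact mul_le_mul_left (mul_inv_le_iff_le_mul.2 (hδm n)) _
  · refine strictMono_nat_of_lt_succ fun n => ?_
    rw [hG, mul_right_comm, mul_right_comm _ _ (q (2 * (n + 1)))]
    refine mul_lt_mul_left ?_ _
    rw [mul_right_comm]
    exact lt_mul_inv_iff_mul_lt.2 (hδv n)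
  · intro n
    rw [logDerCoeff_mul, logDerCoeff_inv]
    cases n with
    | zero => simpa [logDerCoeff_prod] using h 0
    | succ n =>
      rw [Finset.prod_range_succ, logDerCoeff_mul, logDerCoeff_prod, zero_add, ← sub_eq_add_neg]
      · exact sub_ne_zero.2 (hδc n).symm
      · intro j hj
        exact hδz j _ (by have := Finset.mem_range.1 hj; omega)

end Slopes

/-! ### The action of `X * barDer D` on monomials -/

section Step

variable {κ : Cardinal.{u}} [hκ : Fact κ.IsRegular] {K : Type v} [Field K]
  {M : Type u} [CommGroup M] [LinearOrder M] [IsOrderedMonoid M] {S : UpperSet M}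

namespace CutMonoid

theorem below_iff {a b : CutMonoid S} : Below a b ↔ (a.exp = b.exp ∧ a.mon < b.mon) ∨
    (b.exp < a.exp ∧ ∃ u ∈ S, a.mon ≤ b.mon * u ^ (-((a.exp : ℤ) - b.exp))) := by
  unfold Below negCone
  refine or_congr (and_congr ?_ ?_) (and_congr ?_ ?_)
  · rw [sub_eq_zero, Nat.cast_inj]
  · exact mul_inv_lt_iff_lt_mul.trans (by rw [one_mul])
  · rw [sub_pos, Nat.cast_lt]
  · exact exists_congr fun w => and_congr_right fun _ => mul_inv_le_iff_le_mul.trans (by rw [mul_comm])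

theorem exp_le_of_le {a b : CutMonoid S} (h : a ≤ b) : b.exp ≤ a.exp := by
  rcases h with rfl | h
  · exact le_rfl
  · rcases below_iff.1 h with h | h
    · exact h.1.ge
    · exact h.1.le

theorem mon_le_of_le {a b : CutMonoid S} (h : a ≤ b) (hk : a.exp = b.exp) : a.mon ≤ b.mon := by
  rcases h with rfl | h
  · exact le_rfl
  · rcases below_iff.1 h with h | h
    · exact h.2.le
    · exact absurd hk h.1.ne'

theorem le_of_mon_le {a b : CutMonoid S} (hk : a.exp = b.exp) (h : a.mon ≤ b.mon) : a ≤ b := by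
  rcases h.eq_or_lt with h | h
  · exact Or.inl (CutMonoid.ext h hk)
  · exact Or.inr (below_iff.2 (Or.inl ⟨hk, h⟩))

end CutMonoid

variable (D : Derivation K (HahnField κ K M) (HahnField κ K M))

/-- The monomials in the support of `X * ∂(a)`, for `a` in `A`. -/
def derStep (A : Set (CutMonoid S)) : Set (CutMonoid S) :=
  {b | ∃ a ∈ A, b.exp = a.exp + 1 ∧ b.mon ∈ (D (nmono κ K a.mon) : FullSeries K M).supp}

variable {D}

theorem derStep_mono {A B : Set (CutMonoid S)} (h : A ⊆ B) : derStep D A ⊆ derStep D B :=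
  fun _ ⟨a, ha, hb⟩ => ⟨a, h ha, hb⟩

/-- At a fixed power of `X` the ordering is that of `M`, so strong linearity applies directly to the
decreasing monomials. -/
theorem exists_le_of_exp_eventually_const (h0 : ℵ₀ < κ)
    (hD : IsStronglyLinear (D : HahnField κ K M →ₗ[K] HahnField κ K M))
    {a b : ℕ → CutMonoid S} (ha : Antitone a) (hexp : ∀ n, (b n).exp = (a n).exp + 1)
    (hb : ∀ n, (b n).mon ∈ (D (nmono κ K (a n).mon) : FullSeries K M).supp) {N : ℕ}
    (hN : ∀ n, N ≤ n → (a n).exp = (a N).exp) : ∃ i j, i < j ∧ b j ≤ b i := by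
  have hm : Antitone fun n => (a (N + n)).mon := fun i j hij =>
    CutMonoid.mon_le_of_le (ha (by omega)) ((hN _ (by omega)).trans (hN _ (by omega)).symm)
  have h := hD.isNoetherianSet_iUnion_supp hm.isNoetherianSet_range
    ((Set.countable_range _).mk_lt h0)
  obtain ⟨i, j, hij, hle⟩ := isNoetherianSet_iff.1 h (fun n => (b (N + n)).mon) fun n =>
    Set.mem_biUnion (Set.mem_range_self n) (hb (N + n))
  refine ⟨N + i, N + j, by omega, CutMonoid.le_of_mon_le ?_ hle⟩
  rw [hexp, hexp, hN _ (by omega), hN (N + i) (by omega)]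

/-- A counterexample, suitably thinned out, would satisfy all hypotheses of
`not_forall_logDerCoeff_ne_zero`. -/
theorem exists_le_of_exp_strictMono [CharZero K] (h0 : ℵ₀ < κ)
    (hD : IsStronglyLinear (D : HahnField κ K M →ₗ[K] HahnField κ K M))
    {a b : ℕ → CutMonoid S} (ha : Antitone a) (hexp : ∀ n, (b n).exp = (a n).exp + 1)
    (hb : ∀ n, (b n).mon ∈ (D (nmono κ K (a n).mon) : FullSeries K M).supp)
    (hk : StrictMono fun n => (a n).exp) : ∃ i j, i < j ∧ b j ≤ b i := by
  by_contra! hbad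
  have hU : ∀ i j, ∃ u : M, i < j → u ∈ S ∧
      (a j).mon ≤ (a i).mon * u ^ (-(((a j).exp : ℤ) - (a i).exp)) := by
    intro i j
    by_cases hij : i < j
    · rcases ha hij.le with h | h
      · exact absurd (congrArg CutMonoid.exp h) (hk hij).ne'
      · rcases CutMonoid.below_iff.1 h with h | ⟨-, u, hu, h⟩
        · exact absurd h.1 (hk hij).ne'
        · exact ⟨u, fun _ => ⟨hu, h⟩⟩
    -- The slope is only used for `i < j`, so the default value is irrelevant.
    · exact ⟨1, fun h => absurd h hij⟩
  choose U hU using hU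
  -- Since `M` is linearly ordered, failure of `b j ≤ b i` is a strict inequality for every slope in
  -- `S`. The extra factors `X` in `b i` and `b j` cancel in the difference of exponents.
  have hv : ∀ i j, i < j → ∀ w ∈ S,
      (b i).mon * w ^ (-(((a j).exp : ℤ) - (a i).exp)) < (b j).mon := by
    intro i j hij w hw
    by_contra! h
    refine hbad i j hij (Or.inr (CutMonoid.below_iff.2 (Or.inr ⟨?_, w, hw, ?_⟩)))
    · rw [hexp, hexp]
      exact Nat.succ_lt_succ (hk hij)
    · rw [hexp, hexp]
      push_cast
      rwa [add_sub_add_right_eq_sub]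
  set q : ℕ → M := fun n => (a n).mon⁻¹ * (b n).mon with hq
  have hmq : ∀ n, (a n).mon * q n = (b n).mon := fun n => mul_inv_cancel_left _ _
  have hqm : StrictMono q := by
    intro i j hij
    have h1 := (hU i j hij).2
    have h2 := hv i j hij _ (hU i j hij).1
    rw [← hmq i, ← hmq j] at h2
    refine lt_of_mul_lt_mul_left' (a := (a i).mon * U i j ^ (-(((a j).exp : ℤ) - (a i).exp))) ?_
    rw [mul_right_comm]
    exact h2.trans_le (mul_le_mul_left h1 _)
  -- Thin out the sequence so that each new `q` avoids the logarithmic derivatives of all slopes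
  -- between earlier indices. Each of these finitely many supports is avoided eventually, as `q` is
  -- strictly increasing.
  obtain ⟨φ, -, hφ⟩ := exists_seq_of_forall_finset_exists (fun _ : ℕ => True)
    (fun x y => x < y ∧ ∀ c ≤ x, ∀ d ≤ x, logDerCoeff D (q y) (Additive.ofMul (U c d)) = 0) (by
      intro s _
      have h : ∀ᶠ y in Filter.atTop, ∀ x ∈ s, x < y ∧
          ∀ c ≤ x, ∀ d ≤ x, logDerCoeff D (q y) (Additive.ofMul (U c d)) = 0 := by
        rw [Filter.eventually_all_finset]
        intro x _
        refine (Filter.eventually_gt_atTop x).and ?_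
        refine (Filter.eventually_all_finite (Set.finite_Iic x)).2 fun c _ => ?_
        exact (Filter.eventually_all_finite (Set.finite_Iic x)).2 fun d _ =>
          eventually_logDerCoeff_eq_zero hqm _
      obtain ⟨y, hy⟩ := h.exists
      exact ⟨y, trivial, hy⟩)
  have hφm : StrictMono φ := fun i j hij => (hφ i j hij).1
  refine not_forall_logDerCoeff_ne_zero h0 hD S (m := fun n => (a (φ n)).mon)
    (q := fun n => q (φ n)) (k := fun n => ((a (φ n)).exp : ℤ)) (U := fun i j => U (φ i) (φ j))
    ?_ ?_ ?_ ?_ ?_ ?_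
  · exact fun i j hij => Nat.cast_lt.2 (hk (hφm hij))
  · exact fun i j hij => (hU _ _ (hφm hij)).1
  · exact fun i j hij => (hU _ _ (hφm hij)).2
  · intro i j hij w hw
    rw [hmq, hmq]
    exact hv _ _ (hφm hij) w hw
  · intro i c d hc hd
    exact (hφ (max c d) i (max_lt hc hd)).2 _ (hφm.monotone (le_max_left c d)) _
      (hφm.monotone (le_max_right c d))
  · intro i
    rw [← cf_der_nmono, hmq]
    exact hb _

theorem isNoetherianSet_derStep [CharZero K] (h0 : ℵ₀ < κ)
    (hD : IsStronglyLinear (D : HahnField κ K M →ₗ[K] HahnField κ K M))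
    {A : Set (CutMonoid S)} (hA : IsNoetherianSet A) : IsNoetherianSet (derStep D A) := by
  rw [isNoetherianSet_iff]
  intro b hb
  choose a haA hexp hb using hb
  obtain ⟨φ, hφ⟩ := hA.exists_antitone_subseq haA
  suffices h : ∃ i j, i < j ∧ b (φ j) ≤ b (φ i) by
    obtain ⟨i, j, hij, h⟩ := h
    exact ⟨φ i, φ j, φ.strictMono hij, h⟩
  have hmono : Monotone fun n => (a (φ n)).exp := fun i j hij => CutMonoid.exp_le_of_le (hφ hij)
  by_cases hN : ∃ N, ∀ n, N ≤ n → (a (φ n)).exp = (a (φ N)).exp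
  · obtain ⟨N, hN⟩ := hN
    exact exists_le_of_exp_eventually_const h0 hD hφ (fun n => hexp (φ n)) (fun n => hb (φ n)) hN
  · push Not at hN
    choose f hf hf' using hN
    have hlt : ∀ n, (a (φ n)).exp < (a (φ (f n))).exp := fun n =>
      (hmono (hf n)).lt_of_ne (hf' n).symm
    -- The exponents are non-decreasing and never stabilise, so iterating `f` selects indices along
    -- which they increase strictly.
    set ψ : ℕ → ℕ := fun n => f^[n] 0
    have hψ : ∀ n, ψ (n + 1) = f (ψ n) := fun n => Function.iterate_succ_apply' f n 0
    have hψk : StrictMono fun n => (a (φ (ψ n))).exp :=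
      strictMono_nat_of_lt_succ fun n => by rw [hψ]; exact hlt _
    have hψm : StrictMono ψ := by
      refine strictMono_nat_of_lt_succ fun n => ?_
      rw [hψ]
      refine (hf _).lt_of_ne fun h => (hlt (ψ n)).ne (by rw [← h])
    obtain ⟨i, j, hij, h⟩ := exists_le_of_exp_strictMono h0 hD (a := fun n => a (φ (ψ n)))
      (b := fun n => b (φ (ψ n))) (hφ.comp_monotone hψm.monotone) (fun n => hexp _)
      (fun n => hb _) hψk
    exact ⟨ψ i, ψ j, hψm hij, h⟩

end Step

/-! ### Iterating a contracting step -/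

section Iterate

/-- Nash-Williams' argument: in a bad sequence minimal for `rk`, the parents form a Noetherian set,
since a bad sequence of parents could be spliced in to lower the rank. The sequence then lies in `A`
together with the children of a Noetherian set. -/
theorem isNoetherianSet_of_parents {N : Type u} [PartialOrder N] (rk : N → ℕ)
    (par : N → N → Prop) {A s : Set N} (hA : IsNoetherianSet A)
    (hs : ∀ b ∈ s, b ∉ A → ∃ c ∈ s, par c b ∧ b < c ∧ rk c < rk b)
    (hpar : ∀ C ⊆ s, IsNoetherianSet C → IsNoetherianSet {b | ∃ c ∈ C, par c b}) :
    IsNoetherianSet s := by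
  rw [isNoetherianSet_iff_partiallyWellOrderedOn,
    Set.PartiallyWellOrderedOn.iff_not_exists_isMinBadSeq rk]
  rintro ⟨f, hf, hmin⟩
  choose! c hcs hcpar hclt hcrk using hs
  have hC : IsNoetherianSet (c '' {b | b ∈ s ∧ b ∉ A ∧ b ∈ Set.range f}) := by
    rw [isNoetherianSet_iff]
    intro g hg
    by_contra! hbad
    choose b hb hbg using hg
    choose hbs hbA p hp using hb
    -- Splice at the least position `p i` occurring among the children, so that every later parent
    -- belongs to a term of `f` at or after the splice.
    obtain ⟨i, hi⟩ : ∃ i, ∀ j, p i ≤ p j := by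
      obtain ⟨i, -, hi⟩ := WellFounded.has_min (measure p).wf Set.univ ⟨0, trivial⟩
      exact ⟨i, fun j => not_lt.1 (hi j trivial)⟩
    refine hmin (p i) (fun n => if n < p i then f n else g (i + (n - p i))) ?_ ?_ ⟨?_, ?_⟩
    · intro m hm
      rw [if_pos hm]
    · rw [if_neg (lt_irrefl _), Nat.sub_self, add_zero, ← hbg, hp]
      exact hcrk _ (hbs i) (hbA i)
    · intro n
      beta_reduce
      split_ifs
      · exact hf.1 n
      · rw [← hbg]
        exact hcs _ (hbs _) (hbA _)
    · intro m n hmn hle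
      beta_reduce at hle
      split_ifs at hle with h1 h2 h2
      · exact hf.2 m n hmn hle
      · omega
      -- A parent lies above its child, so a comparison of it with an earlier `f m` would pass to
      -- the child, contradicting badness of `f`.
      · refine hf.2 m (p (i + (n - p i))) (h2.trans_le (hi _)) ?_
        rw [hp]
        refine (hclt _ (hbs _) (hbA _)).le.trans ?_
        rwa [hbg]
      · exact hbad _ _ (by omega) hle
  have h := hA.union (hpar _ (by
    rintro _ ⟨b, ⟨hbs, hbA, -⟩, rfl⟩
    exact hcs _ hbs hbA) hC)
  obtain ⟨i, j, hij, hle⟩ := isNoetherianSet_iff.1 h f fun n => by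
    by_cases hn : f n ∈ A
    · exact Or.inl hn
    · exact Or.inr ⟨_, ⟨f n, ⟨hf.1 n, hn, n, rfl⟩, rfl⟩, hcpar _ (hf.1 n) hn⟩
  exact hf.2 i j hij hle

variable {κ : Cardinal.{u}} [hκ : Fact κ.IsRegular] {K : Type v} [Field K]
  {M : Type u} [CommGroup M] [LinearOrder M] [IsOrderedMonoid M] {S : UpperSet M}
  {D : Derivation K (HahnField κ K M) (HahnField κ K M)}

theorem le_domMonomial {s : HahnField κ K M} {m : M} (hm : m ∈ (s : FullSeries K M).supp) :
    m ≤ domMonomial s :=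
  HahnSeries.order_le_of_coeff_ne_zero (x := (s : FullSeries K M)) (g := Expo.of m) hm

/-- The quotient `b / a` is `q X` with `q` in the support of the logarithmic derivative of `a.mon`.
Hence `q` is at most the dominant monomial `u⁻¹` with `u ∈ S`, which is exactly `q X ≺ 1`. -/
theorem lt_of_mem_derStep {a b : CutMonoid S} (ha : a.mon ∈ cutSubgroup S D)
    (hexp : b.exp = a.exp + 1) (hb : b.mon ∈ (D (nmono κ K a.mon) : FullSeries K M).supp) :
    b < a := by
  have hq : a.mon⁻¹ * b.mon ∈ (logDer D a.mon : FullSeries K M).supp := by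
    show _ ≠ _
    rw [← logDerCoeff_apply, ← cf_der_nmono, mul_inv_cancel_left]
    exact hb
  rcases ha with ha | ⟨u, hu, ha⟩
  · rw [ha] at hq
    exact absurd rfl hq
  · refine CutMonoid.below_iff.2 (Or.inr ⟨by omega, u, hu, ?_⟩)
    have h := le_domMonomial hq
    rw [ha] at h
    rw [hexp]
    simpa using inv_mul_le_iff_le_mul.1 h

theorem derStep_subset_overSub
    (hS : ∀ m ∈ cutSubgroup S D,
      (D (nmono κ K m) : FullSeries K M) ∈ NSeries κ K (cutSubgroup S D).toSubmonoid)
    {A : Set (CutMonoid S)} (hA : A ⊆ CutMonoid.overSub S (cutSubgroup S D).toSubmonoid) :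
    derStep D A ⊆ CutMonoid.overSub S (cutSubgroup S D).toSubmonoid :=
  fun _ ⟨_, ha, _, hb⟩ => (hS _ (hA ha)).2 hb

theorem iterate_derStep_subset_overSub
    (hS : ∀ m ∈ cutSubgroup S D,
      (D (nmono κ K m) : FullSeries K M) ∈ NSeries κ K (cutSubgroup S D).toSubmonoid)
    {A : Set (CutMonoid S)} (hA : A ⊆ CutMonoid.overSub S (cutSubgroup S D).toSubmonoid) (n : ℕ) :
    (derStep D)^[n] A ⊆ CutMonoid.overSub S (cutSubgroup S D).toSubmonoid := by
  induction n with
  | zero => exact hA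
  | succ n ih =>
    rw [Function.iterate_succ_apply']
    exact derStep_subset_overSub hS ih

/-- Elements outside `A` arise from a larger element with exponent one less, so
`isNoetherianSet_of_parents` applies with the exponent as rank. -/
theorem isNoetherianSet_iUnion_iterate_derStep [CharZero K] (h0 : ℵ₀ < κ)
    (hD : IsStronglyLinear (D : HahnField κ K M →ₗ[K] HahnField κ K M))
    (hS : ∀ m ∈ cutSubgroup S D,
      (D (nmono κ K m) : FullSeries K M) ∈ NSeries κ K (cutSubgroup S D).toSubmonoid)
    {A : Set (CutMonoid S)} (hA : A ⊆ CutMonoid.overSub S (cutSubgroup S D).toSubmonoid)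
    (hAN : IsNoetherianSet A) : IsNoetherianSet (⋃ n, (derStep D)^[n] A) := by
  refine isNoetherianSet_of_parents CutMonoid.exp (fun a b => b.exp = a.exp + 1 ∧
    b.mon ∈ (D (nmono κ K a.mon) : FullSeries K M).supp) hAN ?_ ?_
  · intro b hb hbA
    obtain ⟨n, hn⟩ := Set.mem_iUnion.1 hb
    cases n with
    | zero => exact absurd hn hbA
    | succ n =>
      rw [Function.iterate_succ_apply'] at hn
      obtain ⟨a, ha, hexp, hba⟩ := hn
      exact ⟨a, Set.mem_iUnion.2 ⟨n, ha⟩, ⟨hexp, hba⟩, lt_of_mem_derStep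
        (iterate_derStep_subset_overSub hS hA n ha) hexp hba, by omega⟩
  · exact fun C _ hC => isNoetherianSet_derStep h0 hD hC

end Iterate

/-! ### Strongly linear maps -/

section StrongLinearity

variable {κ : Cardinal.{u}} [hκ : Fact κ.IsRegular] {K : Type v} [Field K]
  {N : Type u} [CommMonoid N] [PartialOrder N] [IsOrderedCancelMonoid N] {H H' : Submonoid N}
  {P : Type u} [CommMonoid P] [PartialOrder P] [IsOrderedCancelMonoid P] {J : Submonoid P}
  {Q : Type u} [CommMonoid Q] [PartialOrder Q] [IsOrderedCancelMonoid Q] {L : Submonoid Q}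

theorem IsStronglyLinear.comp {Ψ : NSeries κ K J →ₗ[K] NSeries κ K L}
    {Φ : NSeries κ K H →ₗ[K] NSeries κ K J} (hΨ : IsStronglyLinear Ψ) (hΦ : IsStronglyLinear Φ) :
    IsStronglyLinear (Ψ ∘ₗ Φ) := by
  intro I s hs
  obtain ⟨h1, h2⟩ := hΦ I s hs
  obtain ⟨h3, h4⟩ := hΨ I _ h1
  exact ⟨h3, (congrArg Ψ h2).trans h4⟩

theorem isStronglyLinear_zero : IsStronglyLinear (0 : NSeries κ K H →ₗ[K] NSeries κ K J) := by
  intro I s hs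
  have h : (⋃ _ : I, ((0 : NSeries κ K J) : FullSeries K P).supp) = ∅ :=
    Set.iUnion_eq_empty.2 fun _ => Set.eq_empty_of_forall_notMem fun m hm => hm rfl
  refine ⟨⟨?_, ?_, fun m => ?_⟩, NSeries.ext_cf fun m => ?_⟩
  · simp only [LinearMap.zero_apply, h]
    exact Set.isPWO_empty
  · simp only [LinearMap.zero_apply, h, Cardinal.mk_eq_zero]
    exact hκ.out.pos
  · refine Set.finite_empty.subset fun i hi => hi rfl
  · exact (finsum_eq_zero_of_forall_eq_zero fun i => rfl).symm

theorem isStronglyLinear_smul_id (c : K) :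
    IsStronglyLinear (c • LinearMap.id : NSeries κ K H →ₗ[K] NSeries κ K H) := by
  intro I s hs
  have h : ∀ i, ((c • s i : NSeries κ K H) : FullSeries K N).supp ⊆ (s i : FullSeries K N).supp :=
    fun i => supp_smul_subset c (s i)
  refine ⟨⟨hs.1.mono (Set.iUnion_mono h), (mk_le_mk_of_subset (Set.iUnion_mono h)).trans_lt hs.2.1,
    fun m => (hs.2.2 m).subset fun i hi => h i hi⟩, NSeries.ext_cf fun m => ?_⟩
  exact mul_finsum (f := fun i => (s i : FullSeries K N).cf m) c

theorem IsStronglyLinear.smul {Φ : NSeries κ K H →ₗ[K] NSeries κ K J} (hΦ : IsStronglyLinear Φ)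
    (c : K) : IsStronglyLinear (c • Φ) :=
  (isStronglyLinear_smul_id c).comp hΦ

theorem isStronglyLinear_id : IsStronglyLinear (LinearMap.id : NSeries κ K H →ₗ[K] NSeries κ K H) :=
  fun _ _ hs => ⟨hs, rfl⟩

theorem IsStronglyLinear.pow {Φ : NSeries κ K H →ₗ[K] NSeries κ K H} (hΦ : IsStronglyLinear Φ)
    (k : ℕ) : IsStronglyLinear (Φ ^ k) := by
  induction k with
  | zero => exact isStronglyLinear_id
  | succ k ih =>
    rw [pow_succ]
    exact ih.comp hΦ

theorem isStronglyLinear_inclusion (h : H ≤ H') :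
    IsStronglyLinear (Subalgebra.inclusion (NSeries.mono κ K h)).toLinearMap :=
  fun _ _ hs => ⟨hs, rfl⟩

end StrongLinearity

/-! ### Series over `M ×_S X^ℕ` as power series -/

section Power

variable {κ : Cardinal.{u}} [hκ : Fact κ.IsRegular] {K : Type v} [Field K]
  {M : Type u} [CommGroup M] [LinearOrder M] [IsOrderedMonoid M] {S : UpperSet M}
  {H : Submonoid M}

/-- The monomials `m X^k` occurring in a power series over `𝕊`. -/
def powSupp (S : UpperSet M) (F : PowerSeries (HahnField κ K M)) : Set (CutMonoid S) :=
  {a | ((PowerSeries.coeff a.exp F : HahnField κ K M) : FullSeries K M).cf a.mon ≠ 0}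

theorem coeff_toPower (k : ℕ) (P : CutSeries κ K S H) :
    PowerSeries.coeff k (toPower P) = xCoeff k P := PowerSeries.coeff_mk _ _

theorem powSupp_toPower (P : CutSeries κ K S H) :
    powSupp S (toPower P) = (P : FullSeries K (CutMonoid S)).supp := by
  ext a
  unfold powSupp
  rw [Set.mem_ofPred_eq, coeff_toPower]
  rfl

theorem CutSeries.ext_xCoeff {P Q : CutSeries κ K S H} (h : ∀ k, xCoeff k P = xCoeff k Q) :
    P = Q :=
  NSeries.ext_cf fun a => by
    have := congrArg (fun s : HahnField κ K M => (s : FullSeries K M).cf a.mon) (h a.exp)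
    exact this

theorem toPower_injective : Function.Injective (toPower : CutSeries κ K S H → _) :=
  fun P Q h => CutSeries.ext_xCoeff fun k => by rw [← coeff_toPower, h, coeff_toPower]

/-- There are countably many powers of `X`, and `κ` is regular and uncountable. Only Noetherianity
therefore needs a global argument. -/
theorem mk_lt_of_forall_exp (h0 : ℵ₀ < κ) {A : Set (CutMonoid S)}
    (hA : ∀ k, #{m : M | (⟨m, k⟩ : CutMonoid S) ∈ A} < κ) : #A < κ := by
  refine (mk_le_mk_of_subset ?_).trans_lt (mk_iUnion_nat_lt h0 fun k =>
    (mk_image_le (f := fun m : M => (⟨m, k⟩ : CutMonoid S))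
      (s := {m : M | (⟨m, k⟩ : CutMonoid S) ∈ A})).trans_lt (hA k))
  exact fun a ha => Set.mem_iUnion.2 ⟨a.exp, a.mon, ha, rfl⟩

/-- A power series over `𝕊` whose monomials form a Noetherian subset of `H ×_S X^ℕ`. -/
noncomputable def ofPower (h0 : ℵ₀ < κ) (F : PowerSeries (HahnField κ K M))
    (hF : IsNoetherianSet (powSupp S F)) (hF' : powSupp S F ⊆ CutMonoid.overSub S H) :
    CutSeries κ K S H :=
  ⟨⟨fun a => ((PowerSeries.coeff a.mon.exp F : HahnField κ K M) : FullSeries K M).cf a.mon.mon, hF⟩,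
    mk_lt_of_forall_exp (A := powSupp S F) h0 fun k =>
      NSeries.mk_supp_lt (PowerSeries.coeff k F : HahnField κ K M), hF'⟩

theorem toPower_ofPower (h0 : ℵ₀ < κ) (F : PowerSeries (HahnField κ K M))
    (hF : IsNoetherianSet (powSupp S F)) (hF' : powSupp S F ⊆ CutMonoid.overSub S H) :
    toPower (ofPower h0 F hF hF') = F :=
  PowerSeries.ext fun k => by
    rw [coeff_toPower]
    rfl

/-- The coefficient of `X^k`, as a linear map. -/
noncomputable def xCoeffLin (κ : Cardinal.{u}) [Fact κ.IsRegular] (K : Type v) [Field K]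
    (S : UpperSet M) (H : Submonoid M) (k : ℕ) : CutSeries κ K S H →ₗ[K] HahnField κ K M where
  toFun := xCoeff k
  map_add' _ _ := rfl
  map_smul' _ _ := rfl

theorem isStronglyLinear_xCoeffLin (k : ℕ) : IsStronglyLinear (xCoeffLin κ K S H k) := by
  intro I s hs
  have hsub : ∀ m, m ∈ (⋃ i, (xCoeffLin κ K S H k (s i) : FullSeries K M).supp) →
      (⟨m, k⟩ : CutMonoid S) ∈ ⋃ i, (s i : FullSeries K (CutMonoid S)).supp := fun m hm => by
    obtain ⟨i, hi⟩ := Set.mem_iUnion.1 hm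
    exact Set.mem_iUnion.2 ⟨i, hi⟩
  refine ⟨⟨?_, ?_, fun m => hs.2.2 ⟨m, k⟩⟩, rfl⟩
  · rw [isNoetherianSet_iff]
    intro f hf
    obtain ⟨i, j, hij, h⟩ := isNoetherianSet_iff.1 hs.1 (fun n => ⟨f n, k⟩) fun n => hsub _ (hf n)
    exact ⟨i, j, hij, CutMonoid.mon_le_of_le h rfl⟩
  · refine (mk_le_of_injective (f := fun m => ⟨⟨m.1, k⟩, hsub m.1 m.2⟩) ?_).trans_lt hs.2.1
    intro a b hab
    exact Subtype.ext (congrArg CutMonoid.mon (congrArg Subtype.val hab))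

/-- Smallness, finiteness and the value of the sum are all visible on single coefficients of powers
of `X`; Noetherianity of the union is the only condition mixing exponents. -/
theorem isStronglyLinear_of_xCoeff (h0 : ℵ₀ < κ) {N : Type u} [CommMonoid N] [PartialOrder N]
    [IsOrderedCancelMonoid N] {J : Submonoid N} {Φ : NSeries κ K J →ₗ[K] CutSeries κ K S H}
    (hN : ∀ (I : Type u) (s : I → NSeries κ K J), IsNSummable s →
      IsNoetherianSet (⋃ i, (Φ (s i) : FullSeries K (CutMonoid S)).supp))
    (hk : ∀ k, IsStronglyLinear (xCoeffLin κ K S H k ∘ₗ Φ)) : IsStronglyLinear Φ := by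
  intro I s hs
  choose h h' using fun k => hk k I s hs
  refine ⟨⟨hN I s hs, mk_lt_of_forall_exp h0 fun k => ?_, fun a => (h a.exp).2.2 a.mon⟩,
    CutSeries.ext_xCoeff fun k => h' k⟩
  refine (mk_le_mk_of_subset ?_).trans_lt (h k).2.1
  intro m hm
  obtain ⟨i, hi⟩ := Set.mem_iUnion.1 hm
  exact Set.mem_iUnion.2 ⟨i, hi⟩

theorem toPower_add (P Q : CutSeries κ K S H) : toPower (P + Q) = toPower P + toPower Q :=
  PowerSeries.ext fun k => by
    rw [map_add, coeff_toPower, coeff_toPower, coeff_toPower]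
    rfl

theorem toPower_smul (c : K) (P : CutSeries κ K S H) : toPower (c • P) = c • toPower P :=
  PowerSeries.ext fun k => by
    rw [PowerSeries.coeff_smul, coeff_toPower, coeff_toPower]
    rfl

/-- The coefficient of a monomial, as an additive homomorphism. -/
def cfHom (κ : Cardinal.{u}) [Fact κ.IsRegular] (K : Type v) [Field K] {N : Type u} [CommMonoid N]
    [PartialOrder N] [IsOrderedCancelMonoid N] (H : Submonoid N) (m : N) : NSeries κ K H →+ K where
  toFun s := (s : FullSeries K N).cf m
  map_zero' := rfl
  map_add' _ _ := rfl

theorem xCoeff_mul (k : ℕ) (P Q : CutSeries κ K S H) :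
    xCoeff k (P * Q) = ∑ p ∈ Finset.HasAntidiagonal.antidiagonal k, xCoeff p.1 P * xCoeff p.2 Q := by
  refine NSeries.ext_cf fun m => ?_
  change _ = cfHom κ K ⊤ m _
  rw [map_sum]
  change HahnSeries.coeff ((P : FullSeries K (CutMonoid S)) * (Q : FullSeries K (CutMonoid S)))
    (Expo.of ⟨m, k⟩) = ∑ p ∈ Finset.HasAntidiagonal.antidiagonal k,
      HahnSeries.coeff ((xCoeff p.1 P : FullSeries K M) * (xCoeff p.2 Q : FullSeries K M))
        (Expo.of m)
  simp only [HahnSeries.coeff_mul]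
  rw [Finset.sum_sigma']
  -- A factorisation of `m X^k` is a splitting of the exponent `k` together with a factorisation of
  -- `m`.
  refine Finset.sum_bij'
    (fun x _ => ⟨(x.1.mon.exp, x.2.mon.exp), (Expo.of x.1.mon.mon, Expo.of x.2.mon.mon)⟩)
    (fun x _ => (Expo.of ⟨x.2.1.mon, x.1.1⟩, Expo.of ⟨x.2.2.mon, x.1.2⟩)) ?_ ?_ ?_ ?_ ?_
  · intro x hx
    obtain ⟨h1, h2, h3⟩ := Finset.mem_antidiagonal.1 hx
    refine Finset.mem_sigma.2 ⟨Finset.HasAntidiagonal.mem_antidiagonal.2 ?_,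
      Finset.mem_antidiagonal.2 ⟨h1, h2, ?_⟩⟩
    · exact congrArg (fun a : Expo (CutMonoid S) => a.mon.exp) h3
    · exact congrArg (fun a : Expo (CutMonoid S) => Expo.of a.mon.mon) h3
  · rintro ⟨⟨i, j⟩, ⟨a, b⟩⟩ hx
    obtain ⟨h0, h⟩ := Finset.mem_sigma.1 hx
    obtain ⟨h1, h2, h3⟩ := Finset.mem_antidiagonal.1 h
    refine Finset.mem_antidiagonal.2 ⟨h1, h2, ?_⟩
    exact congrArg Expo.of (CutMonoid.ext (congrArg Expo.mon h3)
      (Finset.HasAntidiagonal.mem_antidiagonal.1 h0))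
  · intro x _
    rfl
  · intro x _
    rfl
  · intro x _
    rfl

theorem toPower_mul (P Q : CutSeries κ K S H) : toPower (P * Q) = toPower P * toPower Q :=
  PowerSeries.ext fun k => by
    rw [PowerSeries.coeff_mul, coeff_toPower, xCoeff_mul]
    simp only [coeff_toPower]

theorem toPower_one : toPower (1 : CutSeries κ K S H) = 1 :=
  PowerSeries.ext fun k => NSeries.ext_cf fun m => by
    rw [coeff_toPower, PowerSeries.coeff_one]
    cases k with
    | zero =>
      rw [if_pos rfl]
      by_cases hm : m = 1
      · subst hm
        exact (HahnSeries.coeff_single_same (0 : Expo (CutMonoid S)) (1 : K)).trans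
          (HahnSeries.coeff_single_same (0 : Expo M) (1 : K)).symm
      · refine (HahnSeries.coeff_single_of_ne fun h => hm ?_).trans
          (HahnSeries.coeff_single_of_ne fun h => hm h).symm
        exact congrArg (fun a : Expo (CutMonoid S) => a.mon.mon) h
    | succ k =>
      rw [if_neg k.succ_ne_zero]
      refine HahnSeries.coeff_single_of_ne fun h => k.succ_ne_zero ?_
      exact congrArg (fun a : Expo (CutMonoid S) => a.mon.exp) h

end Power

/-! ### Coefficientwise derivations and Taylor series -/

section Taylor

variable {κ : Cardinal.{u}} [hκ : Fact κ.IsRegular] {K : Type v} [Field K]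
  {M : Type u} [CommGroup M] [LinearOrder M] [IsOrderedMonoid M] {S : UpperSet M}
  {H : Submonoid M} {D : Derivation K (HahnField κ K M) (HahnField κ K M)}

theorem coeff_barDer (k : ℕ) (F : PowerSeries (HahnField κ K M)) :
    PowerSeries.coeff k (barDer D F) = D (PowerSeries.coeff k F) := PowerSeries.coeff_mk _ _

theorem barDer_add (F G : PowerSeries (HahnField κ K M)) :
    barDer D (F + G) = barDer D F + barDer D G :=
  PowerSeries.ext fun k => by simp only [coeff_barDer, map_add]

theorem barDer_smul (c : K) (F : PowerSeries (HahnField κ K M)) :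
    barDer D (c • F) = c • barDer D F :=
  PowerSeries.ext fun k => by rw [coeff_barDer, PowerSeries.coeff_smul, PowerSeries.coeff_smul, coeff_barDer, D.map_smul]

theorem barDer_mul (F G : PowerSeries (HahnField κ K M)) :
    barDer D (F * G) = F * barDer D G + G * barDer D F :=
  PowerSeries.ext fun k => by
    rw [mul_comm G, coeff_barDer, map_add, PowerSeries.coeff_mul, PowerSeries.coeff_mul,
      PowerSeries.coeff_mul, map_sum, ← Finset.sum_add_distrib]
    refine Finset.sum_congr rfl fun p _ => ?_
    rw [D.leibniz, coeff_barDer, coeff_barDer, smul_eq_mul, smul_eq_mul,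
      mul_comm (PowerSeries.coeff p.2 G)]

theorem coeff_taylor (k : ℕ) (s : HahnField κ K M) :
    PowerSeries.coeff k (taylor D s) = ((k.factorial : K)⁻¹) • (D^[k] s) :=
  PowerSeries.coeff_mk _ _

theorem derivative_taylor [CharZero K] (s : HahnField κ K M) :
    PowerSeries.derivative (HahnField κ K M) (taylor D s) = barDer D (taylor D s) :=
  PowerSeries.ext fun k => by
    have h : ((k : HahnField κ K M) + 1) = algebraMap K (HahnField κ K M) ((k : K) + 1) := by
      rw [map_add, map_natCast, map_one]
    rw [PowerSeries.coeff_derivative, coeff_barDer, coeff_taylor, coeff_taylor, D.map_smul,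
      Function.iterate_succ_apply', h, mul_comm, ← Algebra.smul_def, smul_smul]
    congr 1
    rw [Nat.factorial_succ]
    push_cast
    have : (k : K) + 1 ≠ 0 := Nat.cast_add_one_ne_zero k
    field_simp

/-- The equation determines `k + 1` times the coefficient of `X^(k+1)` from that of `X^k`, and `k +
1` is invertible. -/
theorem eq_taylor [CharZero K] {F : PowerSeries (HahnField κ K M)}
    (hF : PowerSeries.derivative (HahnField κ K M) F = barDer D F) :
    F = taylor D (PowerSeries.coeff 0 F) :=
  PowerSeries.ext fun k => by
    induction k with
    | zero => simp [coeff_taylor]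
    | succ k ih =>
      have h1 := congrArg (PowerSeries.coeff k) hF
      have h2 := congrArg (PowerSeries.coeff k)
        (derivative_taylor (D := D) (PowerSeries.coeff 0 F))
      rw [coeff_barDer, PowerSeries.coeff_derivative] at h1 h2
      rw [← ih, ← h1] at h2
      have h : ((k : HahnField κ K M) + 1) = algebraMap K (HahnField κ K M) ((k : K) + 1) := by
        rw [map_add, map_natCast, map_one]
      rw [h, mul_comm, ← Algebra.smul_def, mul_comm, ← Algebra.smul_def] at h2
      exact (smul_right_injective _ (Nat.cast_add_one_ne_zero k : (k : K) + 1 ≠ 0) h2).symm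

/-- Both `d/dX` and `barDer D` are derivations, so the product of two solutions of the differential
equation is again one, with constant coefficient `s * t`. -/
theorem taylor_mul [CharZero K] (s t : HahnField κ K M) :
    taylor D (s * t) = taylor D s * taylor D t := by
  have h := eq_taylor (D := D) (F := taylor D s * taylor D t) (by
    rw [Derivation.leibniz, barDer_mul, derivative_taylor, derivative_taylor, smul_eq_mul,
      smul_eq_mul])
  rw [h, PowerSeries.coeff_mul, Finset.Nat.antidiagonal_zero, Finset.sum_singleton, coeff_taylor,
    coeff_taylor]
  simp

theorem taylor_one : taylor D (1 : HahnField κ K M) = 1 :=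
  PowerSeries.ext fun k => by
    rw [coeff_taylor, PowerSeries.coeff_one]
    cases k with
    | zero => simp
    | succ k =>
      rw [Function.iterate_succ_apply, D.map_one_eq_zero, iterate_map_zero, smul_zero,
        if_neg k.succ_ne_zero]

theorem taylor_add (s t : HahnField κ K M) : taylor D (s + t) = taylor D s + taylor D t :=
  PowerSeries.ext fun k => by
    rw [map_add, coeff_taylor, coeff_taylor, coeff_taylor, iterate_map_add, smul_add]

theorem taylor_smul (c : K) (s : HahnField κ K M) : taylor D (c • s) = c • taylor D s :=
  PowerSeries.ext fun k => by
    have h : ∀ k : ℕ, D^[k] (c • s) = c • D^[k] s := fun k => by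
      induction k with
      | zero => rfl
      | succ k ih => rw [Function.iterate_succ_apply', ih, D.map_smul, Function.iterate_succ_apply']
    rw [PowerSeries.coeff_smul, coeff_taylor, coeff_taylor, h, smul_comm]

theorem powSupp_X_mul_barDer_subset
    (hD : IsStronglyLinear (D : HahnField κ K M →ₗ[K] HahnField κ K M))
    (F : PowerSeries (HahnField κ K M)) :
    powSupp S (PowerSeries.X * barDer D F) ⊆ derStep D (powSupp S F) := by
  rintro ⟨m, k⟩ ha
  cases k with
  | zero =>
    refine absurd ?_ ha
    change (((PowerSeries.coeff 0 (PowerSeries.X * barDer D F) : HahnField κ K M) :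
      FullSeries K M).cf m) = 0
    rw [PowerSeries.coeff_zero_X_mul]
    rfl
  | succ k =>
    change (((PowerSeries.coeff (k + 1) (PowerSeries.X * barDer D F) : HahnField κ K M) :
      FullSeries K M).cf m) ≠ 0 at ha
    rw [PowerSeries.coeff_succ_X_mul, coeff_barDer] at ha
    obtain ⟨n, hn, hm⟩ := Set.mem_iUnion₂.1 (hD.supp_subset _ ha)
    exact ⟨⟨n, k⟩, hn, rfl, hm⟩

theorem powSupp_taylor_subset
    (hD : IsStronglyLinear (D : HahnField κ K M →ₗ[K] HahnField κ K M)) (s : HahnField κ K M) :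
    powSupp S (taylor D s) ⊆
      ⋃ n, (derStep D)^[n] ((fun m => ⟨m, 0⟩) '' (s : FullSeries K M).supp) := by
  have key : ∀ k m, m ∈ ((D^[k] s : HahnField κ K M) : FullSeries K M).supp →
      (⟨m, k⟩ : CutMonoid S) ∈
        (derStep D)^[k] ((fun m => ⟨m, 0⟩) '' (s : FullSeries K M).supp) := by
    intro k
    induction k with
    | zero => exact fun m hm => ⟨m, hm, rfl⟩
    | succ k ih =>
      intro m hm
      rw [Function.iterate_succ_apply'] at hm ⊢
      obtain ⟨n, hn, hm⟩ := Set.mem_iUnion₂.1 (hD.supp_subset _ hm)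
      exact ⟨_, ih n hn, rfl, hm⟩
  intro a ha
  have ha' : a.mon ∈ ((PowerSeries.coeff a.exp (taylor D s) : HahnField κ K M) :
    FullSeries K M).supp := ha
  rw [coeff_taylor] at ha'
  exact Set.mem_iUnion.2 ⟨a.exp, key _ _ (supp_smul_subset _ _ ha')⟩

theorem iterate_derStep_mono {A B : Set (CutMonoid S)} (h : A ⊆ B) (n : ℕ) :
    (derStep D)^[n] A ⊆ (derStep D)^[n] B := by
  induction n with
  | zero => exact h
  | succ n ih =>
    rw [Function.iterate_succ_apply', Function.iterate_succ_apply']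
    exact derStep_mono ih

theorem IsNoetherianSet.image_const {A : Set M} (hA : IsNoetherianSet A) :
    IsNoetherianSet ((fun m => (⟨m, 0⟩ : CutMonoid S)) '' A) := by
  rw [isNoetherianSet_iff]
  intro f hf
  choose p hp hpf using hf
  obtain ⟨i, j, hij, h⟩ := isNoetherianSet_iff.1 hA p hp
  refine ⟨i, j, hij, ?_⟩
  rw [← hpf, ← hpf]
  exact CutMonoid.le_of_mon_le rfl h

end Taylor

/-! ### The contracting derivation and the Taylor morphism. -/

section Main

variable {κ : Cardinal.{u}} [hκ : Fact κ.IsRegular] {K : Type v} [Field K] [CharZero K]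
  {M : Type u} [CommGroup M] [LinearOrder M] [IsOrderedMonoid M] {S : UpperSet M}
  {D : Derivation K (HahnField κ K M) (HahnField κ K M)}

theorem exists_derivation_X_mul_barDer (h0 : ℵ₀ < κ)
    (hD : IsStronglyLinear (D : HahnField κ K M →ₗ[K] HahnField κ K M))
    (hS : ∀ m ∈ cutSubgroup S D,
      (D (nmono κ K m) : FullSeries K M) ∈ NSeries κ K (cutSubgroup S D).toSubmonoid) :
    ∃ E : Derivation K (CutSeries κ K S (cutSubgroup S D).toSubmonoid)
        (CutSeries κ K S (cutSubgroup S D).toSubmonoid),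
      (∀ P, toPower (E P) = PowerSeries.X * barDer D (toPower P)) ∧
      IsStronglyLinear (E : CutSeries κ K S (cutSubgroup S D).toSubmonoid →ₗ[K]
        CutSeries κ K S (cutSubgroup S D).toSubmonoid) ∧
      IsContracting (E : CutSeries κ K S (cutSubgroup S D).toSubmonoid →ₗ[K]
        CutSeries κ K S (cutSubgroup S D).toSubmonoid) := by
  have hsub : ∀ P : CutSeries κ K S (cutSubgroup S D).toSubmonoid,
      powSupp S (PowerSeries.X * barDer D (toPower P)) ⊆
        derStep D (P : FullSeries K (CutMonoid S)).supp := fun P => by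
    rw [← powSupp_toPower]
    exact powSupp_X_mul_barDer_subset hD _
  have hex : ∀ P : CutSeries κ K S (cutSubgroup S D).toSubmonoid,
      ∃ Q : CutSeries κ K S (cutSubgroup S D).toSubmonoid,
        toPower Q = PowerSeries.X * barDer D (toPower P) := fun P =>
    ⟨_, toPower_ofPower h0 _
      ((isNoetherianSet_derStep h0 hD (FullSeries.isNoetherianSet_supp _)).mono (hsub P))
      ((hsub P).trans (derStep_subset_overSub hS P.2.2))⟩
  choose E hE using hex
  have hEsub : ∀ P : CutSeries κ K S (cutSubgroup S D).toSubmonoid,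
      (E P : FullSeries K (CutMonoid S)).supp ⊆
        derStep D (P : FullSeries K (CutMonoid S)).supp := fun P => by
    rw [← powSupp_toPower, hE]
    exact hsub P
  let EL : CutSeries κ K S (cutSubgroup S D).toSubmonoid →ₗ[K]
      CutSeries κ K S (cutSubgroup S D).toSubmonoid :=
    { toFun := E
      map_add' := fun P Q => toPower_injective (by
        rw [toPower_add, hE, hE, hE, toPower_add, barDer_add, mul_add])
      map_smul' := fun c P => toPower_injective (by
        rw [RingHom.id_apply, toPower_smul, hE, hE, toPower_smul, barDer_smul, mul_smul_comm]) }
  let ED := Derivation.mk' EL fun P Q => toPower_injective (by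
    change toPower (E (P * Q)) = toPower (P * E Q + Q * E P)
    rw [toPower_add, toPower_mul, toPower_mul, hE, hE, hE, toPower_mul, barDer_mul]
    ring)
  -- Coefficientwise, the map is zero at `X^0` and is `D` applied to the preceding coefficient at
  -- higher powers, so strong linearity there is inherited from `D`.
  have hx0 : xCoeffLin κ K S (cutSubgroup S D).toSubmonoid 0 ∘ₗ EL = 0 := by
    ext1 P
    change xCoeff 0 (E P) = 0
    rw [← coeff_toPower, hE, PowerSeries.coeff_zero_X_mul]
  have hx1 : ∀ k, xCoeffLin κ K S (cutSubgroup S D).toSubmonoid (k + 1) ∘ₗ EL =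
      (D : HahnField κ K M →ₗ[K] HahnField κ K M) ∘ₗ xCoeffLin κ K S _ k := fun k => by
    ext1 P
    change xCoeff (k + 1) (E P) = D (xCoeff k P)
    rw [← coeff_toPower, hE, PowerSeries.coeff_succ_X_mul, coeff_barDer, coeff_toPower]
  refine ⟨ED, hE, ?_, ?_⟩
  · change IsStronglyLinear EL
    refine isStronglyLinear_of_xCoeff h0 (fun I s hs => ?_) fun k => ?_
    · refine (isNoetherianSet_derStep h0 hD hs.1).mono (Set.iUnion_subset fun i => ?_)
      exact (hEsub (s i)).trans (derStep_mono (Set.subset_iUnion_of_subset i subset_rfl))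
    · cases k with
      | zero => exact hx0 ▸ isStronglyLinear_zero
      | succ k => exact hx1 k ▸ hD.comp (isStronglyLinear_xCoeffLin k)
  · intro P hP
    refine ⟨hP, fun b hb => ?_⟩
    obtain ⟨a, ha, hexp, hba⟩ := hEsub P hb
    exact ⟨a, ha, lt_of_mem_derStep (P.2.2 ha) hexp hba⟩

theorem exists_algHom_taylor (h0 : ℵ₀ < κ)
    (hD : IsStronglyLinear (D : HahnField κ K M →ₗ[K] HahnField κ K M))
    (hS : ∀ m ∈ cutSubgroup S D,
      (D (nmono κ K m) : FullSeries K M) ∈ NSeries κ K (cutSubgroup S D).toSubmonoid) :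
    ∃ T : NSeries κ K (cutSubgroup S D).toSubmonoid →ₐ[K]
        CutSeries κ K S (cutSubgroup S D).toSubmonoid,
      (∀ s, toPower (T s) = taylor D (Subalgebra.inclusion (NSeries.mono κ K le_top) s)) ∧
      IsStronglyLinear T.toLinearMap := by
  have hover : ∀ {A : Set M}, A ⊆ (cutSubgroup S D).toSubmonoid →
      (fun m => (⟨m, 0⟩ : CutMonoid S)) '' A ⊆
        CutMonoid.overSub S (cutSubgroup S D).toSubmonoid := by
    rintro A hA _ ⟨m, hm, rfl⟩
    exact hA hm
  set ι : NSeries κ K (cutSubgroup S D).toSubmonoid →ₐ[K] HahnField κ K M :=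
    Subalgebra.inclusion (NSeries.mono κ K le_top) with hι
  have hsub : ∀ s, powSupp S (taylor D (ι s)) ⊆ ⋃ n, (derStep D)^[n]
      ((fun m => ⟨m, 0⟩) '' (s : FullSeries K M).supp) := fun s => powSupp_taylor_subset hD (ι s)
  have hex : ∀ s, ∃ Q : CutSeries κ K S (cutSubgroup S D).toSubmonoid,
      toPower Q = taylor D (ι s) := fun s =>
    ⟨_, toPower_ofPower h0 _
      ((isNoetherianSet_iUnion_iterate_derStep h0 hD hS (hover s.2.2)
        (FullSeries.isNoetherianSet_supp _).image_const).mono (hsub s))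
      ((hsub s).trans (Set.iUnion_subset (iterate_derStep_subset_overSub hS (hover s.2.2))))⟩
  choose T hT using hex
  let TL : NSeries κ K (cutSubgroup S D).toSubmonoid →ₗ[K]
      CutSeries κ K S (cutSubgroup S D).toSubmonoid :=
    { toFun := T
      map_add' := fun s t => toPower_injective (by
        rw [toPower_add, hT, hT, hT, map_add, taylor_add])
      map_smul' := fun c s => toPower_injective (by
        rw [RingHom.id_apply, toPower_smul, hT, hT, map_smul, taylor_smul]) }
  refine ⟨AlgHom.ofLinearMap TL (toPower_injective (by
      change toPower (T 1) = _
      rw [hT, toPower_one, map_one, taylor_one])) fun s t => toPower_injective (by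
      change toPower (T (s * t)) = toPower (T s * T t)
      rw [toPower_mul, hT, hT, hT, map_mul, taylor_mul]), hT, ?_⟩
  have hx : ∀ k, xCoeffLin κ K S (cutSubgroup S D).toSubmonoid k ∘ₗ TL =
      ((k.factorial : K)⁻¹) •
        (((D : HahnField κ K M →ₗ[K] HahnField κ K M) ^ k) ∘ₗ ι.toLinearMap) := fun k => by
    ext1 s
    change xCoeff k (T s) = ((k.factorial : K)⁻¹) •
      (((D : HahnField κ K M →ₗ[K] HahnField κ K M) ^ k) (ι s))
    rw [← coeff_toPower, hT, coeff_taylor, Module.End.pow_apply]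
    rfl
  change IsStronglyLinear TL
  refine isStronglyLinear_of_xCoeff h0 (fun I s hs => ?_) fun k => ?_
  -- One application to the union of the supports of the whole family bounds all the Taylor series
  -- simultaneously.
  · refine (isNoetherianSet_iUnion_iterate_derStep h0 hD hS (hover ?_)
      hs.1.image_const).mono (Set.iUnion_subset fun i => ?_)
    · exact Set.iUnion_subset fun i => (s i).2.2
    · change (T (s i) : FullSeries K (CutMonoid S)).supp ⊆ _
      rw [← powSupp_toPower, hT]
      refine (hsub (s i)).trans (Set.iUnion_mono fun n => iterate_derStep_mono ?_ n)
      exact Set.image_mono (Set.subset_iUnion_of_subset i subset_rfl)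
  · rw [hx]
    exact ((hD.pow k).comp (isStronglyLinear_inclusion le_top)).smul _

end Main

theorem mainTheorem9
    (κ : Cardinal.{u}) [Fact κ.IsRegular] (hκ : ℵ₀ < κ)
    (K : Type v) [Field K] [LinearOrder K] [IsStrictOrderedRing K]
    (M : Type u) [CommGroup M] [LinearOrder M] [IsOrderedMonoid M] [Nontrivial M]
    (l : M → HahnField κ K M)
    (D : Derivation K (HahnField κ K M) (HahnField κ K M))
    (hD : IsDiffPreLogHahnField l D)
    (hl : IsTruncationClosed (Set.range l))
    (S : UpperSet M)
    (hS : ∀ m ∈ cutSubgroup S D,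
      (D (nmono κ K m) : FullSeries K M) ∈ NSeries κ K (cutSubgroup S D).toSubmonoid) :
    (∃ E : Derivation K (CutSeries κ K S (cutSubgroup S D).toSubmonoid)
        (CutSeries κ K S (cutSubgroup S D).toSubmonoid),
      (∀ P, toPower (E P) = PowerSeries.X * barDer D (toPower P)) ∧
      IsStronglyLinear (E : CutSeries κ K S (cutSubgroup S D).toSubmonoid →ₗ[K]
        CutSeries κ K S (cutSubgroup S D).toSubmonoid) ∧
      IsContracting (E : CutSeries κ K S (cutSubgroup S D).toSubmonoid →ₗ[K]
        CutSeries κ K S (cutSubgroup S D).toSubmonoid)) ∧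
    (∃ T : NSeries κ K (cutSubgroup S D).toSubmonoid →ₐ[K]
        CutSeries κ K S (cutSubgroup S D).toSubmonoid,
      (∀ s, toPower (T s) = taylor D (Subalgebra.inclusion (NSeries.mono κ K le_top) s)) ∧
      IsStronglyLinear T.toLinearMap) := by
  exact ⟨exists_derivation_X_mul_barDer hκ hD.stronglyLinear hS,
    exists_algHom_taylor hκ hD.stronglyLinear hS⟩
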